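/- **Conventions.** All groups are finite, $x^g=g^{-1}xg$, and $\psi^g(x)=\psi(gxg^{-1})$ for a character $\psi$ of a subgroup. $\mathcal C$ is the class of finite groups $G$ such that every subgroup and every quotient group of $G$ is abelian or has a noncentral abelian normal subgroup. For $K\unlhd H\le L\le G$ put $\widehat H=\frac1{|H|}\sum_{h\in H}h$; let $\varepsilon(H,K)=\widehat K$ if $H=K$ and otherwise $\varepsilon(H,K)=\prod(\widehat K-\widehat M)$, with $M$ running over the minimal ones among the normal subgroups of $H$ that contain $K$ properly; and let $e(L,H,K)$ be the sum of the distinct $L$-conjugates of $\varepsilon(H,K)$. For a character $\chi$ of $L$, $\mathbb Q(\chi)$ is the field generated by its values and $e_{\mathbb Q}(\chi)=\frac{\chi(1)}{|L|}\sum_{\sigma\in \mathrm{Gal}(\mathbb Q(\chi)/\mathbb Q)}\sum_{g\in L}\sigma(\chi(g))g^{-1}\in\mathbb QL$. For $a\in\mathbb QG$ and $M\le G$, $\mathrm{Cen}_M(a)=\{g\in M: ga=ag\}$. **Leaves.** Let $N\unlhd G$. An $N$-linear character triple of $G$ is $(H,A,\vartheta)$ with $A\unlhd H\le G$ and $\vartheta$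 an $H$-invariant linear character of $A$ with $\ker\vartheta^G=N$. For each character triple $(H,A,\vartheta)$ with $\vartheta$ linear fix a normal subgroup $\mathcal A\supseteq\ker\vartheta$ of $H$, of maximal order such that $\mathcal A/\ker\vartheta$ is abelian, and fix a set of representatives of the orbits of $\mathrm{Aut}(\mathbb C/\mathbb Q(\vartheta))\times H$ on the set of linear characters $\varphi$ of $\mathcal A$ with $\varphi|_A=\vartheta$ and $\ker\varphi^G=\ker\vartheta^G$, where $\sigma$ acts by $\varphi\mapsto\sigma\circ\varphi$ and $h$ by $\varphi\mapsto\varphi^h$. The direct Clifford correspondents of $(H,A,\vartheta)$ are the triples $(I_H(\varphi),\mathcal A,\varphi)$ with $\varphi$ a representative and $I_H(\varphi)=\{g\in H:\varphi^g=\varphi\}$ if $H\ne A$; there are none if $H=A$. A leaf $(H,H,\vartheta)$ of height $n\geq 1$ with nodes $(H_i,A_i,\vartheta_i)$, $1\le i\le n$, is the end of a path of distinct $N$-linear character triples $(H_1,A_1,\vartheta_1)=(G,N,1_N),\dots,(H_n,A_n,\vartheta_n)=(H,H,\vartheta)$, each $(H_{i+1},A_{i+1},\vartheta_{i+1})$ being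 a direct Clifford correspondent of $(H_i,A_i,\vartheta_i)$. **Crossed products.** For a ring $R$, a group $Q$, a map $\sigma:Q\to\mathrm{Aut}(R)$ and a map $\tau:Q\times Q\to R^\times$ with $\sigma_g(\sigma_h(r))\tau(g,h)=\tau(g,h)\sigma_{gh}(r)$ and $\tau(g,h)\tau(gh,k)=\sigma_g(\tau(h,k))\tau(g,hk)$, the crossed product $R*^\sigma_\tau Q$ is the free left $R$-module with basis $(u_g)_{g\in Q}$ and multiplication given by $u_gr=\sigma_g(r)u_g$, $u_gu_h=\tau(g,h)u_{gh}$. **Theorem.** Let $G\in\mathcal C$, let $N\unlhd G$, let $(H,H,\vartheta)$ be a leaf of height $n$ with nodes $(H_i,A_i,\vartheta_i)$, and let $K=\ker\vartheta$, $k=[H:K]$, $\xi_k$ a primitive $k$-th root of unity. For $1\le i\le n-1$ put $C_i=\mathrm{Cen}_{H_i}(e(H_{i+1},H,K))$ and $k_i=[H_i:\mathrm{Cen}_{H_i}(e_{\mathbb Q}(\vartheta^{H_{i+1}}))]$. Then $H_{i+1}\unlhd C_i=\mathrm{Cen}_{H_i}(e_{\mathbb Q}(\vartheta^{H_{i+1}}))$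 for all $1\le i\le n-1$, $C_{n-1}=N_{H_{n-1}}(K)$ if $n\ge2$, and there is a ring isomorphism $$\mathbb QG\,e_{\mathbb Q}(\vartheta^G)\;\cong\; M_{k_1}\Bigl(M_{k_2}\bigl(\cdots M_{k_{n-1}}\bigl(\mathbb Q(\xi_k)*^{\sigma_{n-1}}_{\tau_{n-1}}N_{H_{n-1}}(K)/H\bigr)*^{\sigma_{n-2}}_{\tau_{n-2}}C_{n-2}/H_{n-1}\cdots\bigr)*^{\sigma_1}_{\tau_1}C_1/H_2\Bigr)$$ (for $n=1$ the right-hand side is $\mathbb Q(\xi_k)$). Here, for $1\le i\le n-1$, the coefficient ring $R_{i+1}$ of the crossed product with $C_i/H_{i+1}$ (so that $R_n=\mathbb Q(\xi_k)$ and $R_i=M_{k_i}(R_{i+1}*^{\sigma_i}_{\tau_i}C_i/H_{i+1})$) is itself isomorphic to $\mathbb QH_{i+1}e_{\mathbb Q}(\vartheta^{H_{i+1}})$. After any choice of an isomorphism $\eta_{i+1}:\mathbb QH_{i+1}e_{\mathbb Q}(\vartheta^{H_{i+1}})\to R_{i+1}$ and of representatives $\bar q\in C_i$ of the cosets $q\in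 C_i/H_{i+1}$, the action and the twisting are $\sigma_i(q)=\eta_{i+1}\circ(a\mapsto \bar q a\bar q^{-1})\circ\eta_{i+1}^{-1}$ and $\tau_i(p,q)=\eta_{i+1}\bigl(g\,e_{\mathbb Q}(\vartheta^{H_{i+1}})\bigr)$, where $g\in H_{i+1}$ and $\bar p\,\bar q=g\,\overline{pq}$. The isomorphism exists for every such choice. -/

import Mathlib

universe u v w

noncomputable section

/-! ### The class of groups -/

/-- A group is abelian or contains a noncentral abelian normal subgroup. -/
def AbelianOrNoncentral (X : Type u) [Group X] : Prop :=
  (∀ x y : X, x * y = y * x) ∨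
    ∃ B : Subgroup X, B.Normal ∧ (∀ x ∈ B, ∀ y ∈ B, x * y = y * x) ∧ ¬ B ≤ Subgroup.center X

/-- The class `𝒞` (finiteness is a separate hypothesis): every subgroup and every quotient group
of `G` is abelian or contains a noncentral abelian normal subgroup. -/
def InClassC (G : Type u) [Group G] : Prop :=
  (∀ S : Subgroup G, AbelianOrNoncentral S) ∧
    ∀ (N : Subgroup G) [N.Normal], AbelianOrNoncentral (G ⧸ N)

/-! ### Linear characters, induced characters, character triples -/

section Characters

variable {G : Type u} [Group G]

open Classical in
/-- A linear character of a subgroup, extended by zero to the whole group. -/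
def extChar {A : Subgroup G} (θ : A →* ℂˣ) (g : G) : ℂ :=
  if h : g ∈ A then (θ ⟨g, h⟩ : ℂ) else 0

/-- The kernel of a linear character of a subgroup, as a subgroup of the whole group. -/
def kerChar {A : Subgroup G} (θ : A →* ℂˣ) : Subgroup G :=
  θ.ker.map A.subtype

/-- The character of `L` induced from a linear character `θ` of a subgroup `A ≤ L`
(both inside `G`), by the usual formula `θ^L(g) = |A|⁻¹ ∑_{x ∈ L} θ°(x⁻¹ g x)`, where `θ°` is the
extension of `θ` by zero. As a function on `G` it vanishes off `L`. -/
def indChar {A : Subgroup G} (L : Subgroup G) (θ : A →* ℂˣ) (g : G) : ℂ :=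
  (Nat.card A : ℂ)⁻¹ * ∑ᶠ x : L, extChar θ ((x : G)⁻¹ * g * x)

/-- The kernel `{g | χ(g) = χ(1)}` of a character. -/
def charKernel (χ : G → ℂ) : Set G := {g | χ g = χ 1}

/-- The data `(H, A, θ)` of a character triple inside `G` with a linear character `θ` of `A`. -/
structure LinTriple (G : Type u) [Group G] where
  /-- the first entry -/
  H : Subgroup G
  /-- the second entry -/
  A : Subgroup G
  /-- the linear character -/
  θ : A →* ℂˣ

/-- `(H, A, θ)` is a character triple: `A ⊴ H` and `θ` is invariant in `H`. -/
structure LinTriple.IsCharTriple (t : LinTriple G) : Prop where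
  le : t.A ≤ t.H
  normal : (t.A.subgroupOf t.H).Normal
  invariant : ∀ h ∈ t.H, ∀ x : G, extChar t.θ (h * x * h⁻¹) = extChar t.θ x

/-- `(H, A, θ)` is an `N`-linear character triple of `G`: moreover `ker θ^G = N`. -/
structure LinTriple.IsNLinear (t : LinTriple G) (N : Subgroup G) : Prop extends
    t.IsCharTriple where
  ker_ind : charKernel (indChar ⊤ t.θ) = N

/-- `B` is normal in `H`, contains `ker θ`, and `B / ker θ` is abelian. -/
structure LinTriple.IsAbelianOver (t : LinTriple G) (B : Subgroup G) : Prop where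
  le : B ≤ t.H
  normal : (B.subgroupOf t.H).Normal
  ker_le : kerChar t.θ ≤ B
  comm : ∀ x ∈ B, ∀ y ∈ B, x⁻¹ * y⁻¹ * x * y ∈ kerChar t.θ

/-- The inertia group `I_H(φ) = {g ∈ H | φ^g = φ}`, where `φ^g(x) = φ(g x g⁻¹)`. -/
def inertia (H : Subgroup G) {B : Subgroup G} (φ : B →* ℂˣ) : Subgroup G where
  carrier := {g | g ∈ H ∧ ∀ x : G, extChar φ (g * x * g⁻¹) = extChar φ x}
  one_mem' := ⟨H.one_mem, by simp⟩
  mul_mem' := by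
    rintro a b ⟨ha, ha'⟩ ⟨hb, hb'⟩
    refine ⟨H.mul_mem ha hb, fun x => ?_⟩
    rw [← hb' x, ← ha' (b * x * b⁻¹)]
    congr 1
    group
  inv_mem' := by
    rintro a ⟨ha, ha'⟩
    refine ⟨H.inv_mem ha, fun x => ?_⟩
    rw [← ha' (a⁻¹ * x * a⁻¹⁻¹)]
    congr 1
    group

/-- The linear characters `φ` of `B` lying above `θ` (that is, `φ` restricts to `θ` on `A`)
with `ker φ^G = ker θ^G`. -/
def LinTriple.linAbove (t : LinTriple G) (B : Subgroup G) : Set (B →* ℂˣ) :=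
  {φ | t.A ≤ B ∧ (∀ a ∈ t.A, extChar φ a = extChar t.θ a) ∧
    charKernel (indChar ⊤ φ) = charKernel (indChar ⊤ t.θ)}

/-- `φ` and `φ'` lie in the same orbit under `Aut(ℂ | θ) × H`: `φ' = σ ∘ φ^h` for some `h ∈ H` and
some automorphism `σ` of `ℂ` fixing the values of `θ` (equivalently, fixing `ℚ(θ)` pointwise). -/
def LinTriple.SameOrbit (t : LinTriple G) {B : Subgroup G} (φ φ' : B →* ℂˣ) : Prop :=
  ∃ σ : ℂ ≃+* ℂ, (∀ a : t.A, σ (t.θ a : ℂ) = (t.θ a : ℂ)) ∧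
    ∃ h ∈ t.H, ∀ x : G, extChar φ' x = σ (extChar φ (h * x * h⁻¹))

/-- The choices that are fixed once and for all: for every character triple `t = (H, A, θ)`, a
normal subgroup `𝒜_t` of `H` of maximal order among those containing `ker θ` with abelian
quotient by `ker θ`, and a set of representatives of the orbits of the double action on the linear
characters of `𝒜_t` above `θ`. -/
structure CliffordChoice (G : Type u) [Group G] where
  /-- the subgroup `𝒜_t` -/
  A : LinTriple G → Subgroup G
  abelianOver : ∀ t : LinTriple G, t.IsCharTriple → t.IsAbelianOver (A t)
  maximal : ∀ t : LinTriple G, t.IsCharTriple → ∀ B : Subgroup G, t.IsAbelianOver B →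
    Nat.card B ≤ Nat.card (A t)
  /-- the orbit representatives -/
  reps : ∀ t : LinTriple G, Set (A t →* ℂˣ)
  reps_subset : ∀ t : LinTriple G, t.IsCharTriple → reps t ⊆ t.linAbove (A t)
  reps_unique : ∀ t : LinTriple G, t.IsCharTriple → ∀ φ ∈ t.linAbove (A t),
    ∃! ψ, ψ ∈ reps t ∧ t.SameOrbit ψ φ

/-- The set `Cl(H, A, θ)` of direct Clifford correspondents: empty for `H = A`, and otherwise all
`(I_H(φ), 𝒜, φ)` with `φ` among the orbit representatives. -/
def CliffordChoice.Cl (c : CliffordChoice G) (t : LinTriple G) : Set (LinTriple G) :=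
  {s | t.H ≠ t.A ∧ ∃ φ ∈ c.reps t, s = ⟨inertia t.H φ, c.A t, φ⟩}

/-- `v 1, …, v n` is the directed path in the graph of `N`-linear character triples (edges:
direct Clifford correspondents) from the root `(G, N, 1_N)` to `(H, H, θ)`. In other words,
`(H, H, θ)` is a leaf of height `n` of the tree, and `v i` is its `i`-th node. The values of `v`
outside `{1, …, n}` are irrelevant. -/
structure CliffordChoice.IsLeafPath (c : CliffordChoice G) (N : Subgroup G) (n : ℕ)
    (v : ℕ → LinTriple G) (H : Subgroup G) (θ : H →* ℂˣ) : Prop where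
  one_le : 1 ≤ n
  root : v 1 = ⟨⊤, N, 1⟩
  leaf : v n = ⟨H, H, θ⟩
  vertex : ∀ i, 1 ≤ i → i ≤ n → (v i).IsNLinear N
  edge : ∀ i, 1 ≤ i → i < n → v (i + 1) ∈ c.Cl (v i)
  distinct : Set.InjOn v (Set.Icc 1 n)

end Characters

/-! ### Elements of the rational group algebra -/

section GroupAlgebra

variable {G : Type u} [Group G]

/-- The group element `g` in `ℚG`. -/
abbrev gel (g : G) : MonoidAlgebra ℚ G := MonoidAlgebra.of ℚ G g

/-- `ℚL` as a subalgebra of `ℚG`, for a subgroup `L` of `G`. -/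
def subAlg (L : Subgroup G) : Subalgebra ℚ (MonoidAlgebra ℚ G) :=
  (MonoidAlgebra.mapDomainAlgHom ℚ ℚ L.subtype).range

theorem gel_mem_subAlg {L : Subgroup G} {g : G} (hg : g ∈ L) : gel g ∈ subAlg L :=
  ⟨MonoidAlgebra.of ℚ L ⟨g, hg⟩, by simp [MonoidAlgebra.mapDomainAlgHom]⟩

/-- `L̂ = |L|⁻¹ ∑_{ℓ ∈ L} ℓ`. -/
def hat (L : Subgroup G) : MonoidAlgebra ℚ G :=
  (Nat.card L : ℚ)⁻¹ • ∑ᶠ x : L, gel (x : G)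

theorem gel_mul_hat [Finite G] {L : Subgroup G} {g : G} (hg : g ∈ L) :
    gel g * hat L = hat L := by
  have := Fintype.ofFinite L
  rw [hat, mul_smul_comm, finsum_eq_sum_of_fintype, Finset.mul_sum]
  congr 1
  exact Fintype.sum_equiv (Equiv.mulLeft (⟨g, hg⟩ : L)) _ _ fun x => by simp [gel]

theorem hat_mul_gel [Finite G] {L : Subgroup G} {g : G} (hg : g ∈ L) :
    hat L * gel g = hat L := by
  have := Fintype.ofFinite L
  rw [hat, smul_mul_assoc, finsum_eq_sum_of_fintype, Finset.sum_mul]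
  congr 1
  exact Fintype.sum_equiv (Equiv.mulRight (⟨g, hg⟩ : L)) _ _ fun x => by simp [gel]

theorem hat_commute_of_le [Finite G] {K L : Subgroup G} (h : K ≤ L) :
    Commute (hat K) (hat L) := by
  have := Fintype.ofFinite K
  have h1 : hat K * hat L = (Nat.card K : ℚ)⁻¹ • ∑ _x : K, hat L := by
    rw [hat, smul_mul_assoc, finsum_eq_sum_of_fintype, Finset.sum_mul]
    congr 1
    exact Finset.sum_congr rfl fun x _ => gel_mul_hat (h x.2)
  have h2 : hat L * hat K = (Nat.card K : ℚ)⁻¹ • ∑ _x : K, hat L := by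
    conv_lhs => rw [hat.eq_1 K, mul_smul_comm, finsum_eq_sum_of_fintype, Finset.mul_sum]
    congr 1
    exact Finset.sum_congr rfl fun x _ => hat_mul_gel (h x.2)
  exact h1.trans h2.symm

theorem hat_commute_of_normal [Finite G] {H L M : Subgroup G} (hL : L ≤ H)
    (hLn : (L.subgroupOf H).Normal) (hM : M ≤ H) : Commute (hat L) (hat M) := by
  have := Fintype.ofFinite M
  have := Fintype.ofFinite L
  have key : ∀ g ∈ H, Commute (hat L) (gel g) := by
    intro g hg
    have hc : ∀ x ∈ L, ∀ h ∈ H, h * x * h⁻¹ ∈ L := fun x hx h hh =>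
      hLn.conj_mem ⟨x, hL hx⟩ hx ⟨h, hh⟩
    let f : L ≃ L :=
      { toFun := fun x => ⟨g * x.1 * g⁻¹, hc x.1 x.2 g hg⟩
        invFun := fun x => ⟨g⁻¹ * x.1 * g, by
          simpa using hc x.1 x.2 g⁻¹ (H.inv_mem hg)⟩
        left_inv := fun x => Subtype.ext (by simp [mul_assoc])
        right_inv := fun x => Subtype.ext (by simp [mul_assoc]) }
    have e : gel g * (∑ x : L, gel x.1) = (∑ x : L, gel x.1) * gel g := by
      rw [Finset.mul_sum, Finset.sum_mul]
      refine Fintype.sum_equiv f _ _ fun x => ?_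
      rw [gel, gel, gel, ← map_mul, ← map_mul]
      congr 1
      simp [f]
    rw [hat.eq_1 L, finsum_eq_sum_of_fintype]
    exact Commute.smul_left e.symm _
  rw [hat.eq_1 M, finsum_eq_sum_of_fintype]
  refine Commute.smul_right ?_ _
  exact Commute.sum_right Finset.univ (fun x : M => gel x.1) (hat L) fun x _ => key x.1 (hM x.2)

/-- `L` is a normal subgroup of `H` which contains `K` properly. -/
def IsNormalAbove (H K L : Subgroup G) : Prop :=
  L ≤ H ∧ (L.subgroupOf H).Normal ∧ K < L

open Classical in
/-- `ε(H, K)`: it is `K̂` if `H = K`, and otherwise the product of all `K̂ - L̂`, where `L` runs over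
the minimal ones among the normal subgroups of `H` containing `K` properly. -/
def eps [Finite G] (H K : Subgroup G) : MonoidAlgebra ℚ G :=
  if H = K then hat K
  else
    (Set.toFinite {L : Subgroup G | Minimal (IsNormalAbove H K) L}).toFinset.noncommProd
      (fun L => hat K - hat L) (by
        intro L hL M hM _
        simp only [Set.Finite.coe_toFinset, Set.mem_ofPred_eq] at hL hM
        obtain ⟨⟨hL1, hL2, hL3⟩, -⟩ := hL
        obtain ⟨⟨hM1, hM2, hM3⟩, -⟩ := hM
        exact ((Commute.refl _).sub_right (hat_commute_of_le hM3.le)).sub_left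
          ((hat_commute_of_le hL3.le).symm.sub_right (hat_commute_of_normal hL1 hL2 hM1)))

/-- `e(L, H, K)`: the sum of all the distinct `L`-conjugates of `ε(H, K)`. -/
def eSum [Finite G] (L H K : Subgroup G) : MonoidAlgebra ℚ G :=
  ∑ᶠ a ∈ {a | ∃ x ∈ L, a = gel x⁻¹ * eps H K * gel x}, a

/-- The field `ℚ(χ)` generated by the values of `χ`. -/
abbrev charField (χ : G → ℂ) : IntermediateField ℚ ℂ :=
  IntermediateField.adjoin ℚ (Set.range χ)

/-- `e_ℚ(χ) = (χ(1) / |L|) ∑_{σ ∈ Gal(ℚ(χ)/ℚ)} ∑_{g ∈ L} σ(χ(g)) g⁻¹` in `ℚL ⊆ ℚG`, for a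
character `χ` of the subgroup `L`, given as a function on `G` vanishing off `L`. Here
`χ(1) ∑_σ σ(χ(g))` is written as the trace of `χ(1) χ(g)` from the Galois extension `ℚ(χ)` to `ℚ`;
recall that `χ(1)` is an integer. -/
def eQ (L : Subgroup G) (χ : G → ℂ) : MonoidAlgebra ℚ G :=
  ∑ᶠ g : L, ((Nat.card L : ℚ)⁻¹ * Algebra.trace ℚ (charField χ)
    (⟨χ 1, IntermediateField.subset_adjoin _ _ ⟨1, rfl⟩⟩ *
      ⟨χ g, IntermediateField.subset_adjoin _ _ ⟨(g : G), rfl⟩⟩)) • gel (g : G)⁻¹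

theorem eQ_mem_subAlg [Finite G] (L : Subgroup G) (χ : G → ℂ) : eQ L χ ∈ subAlg L := by
  have := Fintype.ofFinite L
  rw [eQ, finsum_eq_sum_of_fintype]
  exact sum_mem fun g _ => (subAlg L).smul_mem (gel_mem_subAlg (L.inv_mem g.2)) _

/-- The primitive central idempotent `e_ℚ(θ^L)` of `ℚL`, for `θ` a linear character of a
subgroup of `L`. -/
def eInd {H : Subgroup G} (L : Subgroup G) (θ : H →* ℂˣ) : MonoidAlgebra ℚ G :=
  eQ L (indChar L θ)

/-- The component `ℚL e_ℚ(θ^L) = {b e_ℚ(θ^L) | b ∈ ℚL}`, inside `ℚG`. It does not contain the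
identity of `ℚG` in general (its identity is `e_ℚ(θ^L)`), hence a non-unital subring. -/
def component [Finite G] {H : Subgroup G} (L : Subgroup G) (θ : H →* ℂˣ) :
    NonUnitalSubring (MonoidAlgebra ℚ G) where
  carrier := {a | ∃ b ∈ subAlg L, a = b * eInd L θ}
  zero_mem' := ⟨0, zero_mem _, by simp⟩
  add_mem' := by
    rintro _ _ ⟨b, hb, rfl⟩ ⟨b', hb', rfl⟩
    exact ⟨b + b', add_mem hb hb', by rw [add_mul]⟩
  neg_mem' := by
    rintro _ ⟨b, hb, rfl⟩
    exact ⟨-b, neg_mem hb, by rw [neg_mul]⟩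
  mul_mem' := by
    rintro _ _ ⟨b, hb, rfl⟩ ⟨b', hb', rfl⟩
    exact ⟨b * eInd L θ * b', mul_mem (mul_mem hb (eQ_mem_subAlg _ _)) hb', by
      simp only [mul_assoc]⟩

/-- `Cen_M(a) = {g ∈ M | g a = a g}` for an element `a` of `ℚG` and a subgroup `M` of `G`. -/
def cen (M : Subgroup G) (a : MonoidAlgebra ℚ G) : Subgroup G where
  carrier := {g | g ∈ M ∧ Commute (gel g) a}
  one_mem' := ⟨M.one_mem, by rw [gel, map_one]; exact Commute.one_left a⟩
  mul_mem' := by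
    rintro x y ⟨hx, hx'⟩ ⟨hy, hy'⟩
    exact ⟨M.mul_mem hx hy, by rw [gel, map_mul]; exact hx'.mul_left hy'⟩
  inv_mem' := by
    rintro x ⟨hx, hx'⟩
    refine ⟨M.inv_mem hx, ?_⟩
    have h1 : gel x⁻¹ * gel x = 1 := by rw [gel, gel, ← map_mul]; simp [MonoidAlgebra.one_def]
    have h2 : gel x * gel x⁻¹ = 1 := by rw [gel, gel, ← map_mul]; simp [MonoidAlgebra.one_def]
    have h3 : a = gel x⁻¹ * (a * gel x) := by
      rw [← hx'.eq, ← mul_assoc, h1, one_mul]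
    calc gel x⁻¹ * a = gel x⁻¹ * (a * gel x) * gel x⁻¹ := by
            rw [mul_assoc, mul_assoc, h2, mul_one]
      _ = a * gel x⁻¹ := by rw [← h3]

end GroupAlgebra

/-! ### Crossed products -/

/-- An action `σ` and a twisting `τ` of a group `Q` on a ring `R`, subject to the conditions which
make the crossed product `R *^σ_τ Q` associative. -/
structure CrossedSystem (R : Type v) [Ring R] (Q : Type w) [Group Q] where
  /-- the action -/
  σ : Q → (R ≃+* R)
  /-- the twisting -/
  τ : Q → Q → Rˣ
  action : ∀ g h r, σ g (σ h r) * τ g h = τ g h * σ (g * h) r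
  cocycle : ∀ g h k, (τ g h * τ (g * h) k : R) = σ g (τ h k) * τ g (h * k)

namespace CrossedSystem

variable {R : Type v} [Ring R] {Q : Type w} [Group Q] (S : CrossedSystem R Q)

/-- The crossed multiplication on the free left `R`-module with basis `u_g`, `g ∈ Q`:
`(r u_g) (s u_h) = r σ_g(s) τ(g, h) u_{gh}`, extended biadditively. -/
def mul (a b : Q →₀ R) : Q →₀ R :=
  a.sum fun g r => b.sum fun h s => Finsupp.single (g * h) (r * S.σ g s * S.τ g h)

theorem mul_single_single (g h : Q) (r s : R) :
    S.mul (Finsupp.single g r) (Finsupp.single h s) =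
      Finsupp.single (g * h) (r * S.σ g s * S.τ g h) := by
  rw [mul, Finsupp.sum_single_index, Finsupp.sum_single_index] <;> simp

theorem mul_add' (a b c : Q →₀ R) : S.mul a (b + c) = S.mul a b + S.mul a c := by
  simp only [mul]
  rw [← Finsupp.sum_add]
  refine Finsupp.sum_congr fun g _ => ?_
  exact Finsupp.sum_add_index' (fun h => by simp)
    (fun h s s' => by simp [mul_add, add_mul])

theorem add_mul' (a b c : Q →₀ R) : S.mul (a + b) c = S.mul a c + S.mul b c := by
  simp only [mul]
  refine Finsupp.sum_add_index' (fun h => by simp) (fun h s s' => ?_)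
  rw [← Finsupp.sum_add]
  exact Finsupp.sum_congr fun g _ => by simp [add_mul]

theorem zero_mul' (a : Q →₀ R) : S.mul 0 a = 0 := Finsupp.sum_zero_index

theorem mul_zero' (a : Q →₀ R) : S.mul a 0 = 0 := by simp [mul]

theorem σ_one (r : R) : S.σ 1 r * S.τ 1 1 = S.τ 1 1 * r := by
  obtain ⟨s, rfl⟩ := (S.σ 1).surjective r
  simpa using S.action 1 1 s

theorem τ_one_left (h : Q) : S.τ 1 h = S.τ 1 1 := by
  have h1 := S.cocycle 1 1 h
  simp only [one_mul] at h1
  have h2 : (S.τ 1 1 : R) = S.σ 1 (S.τ 1 h) := (S.τ 1 h).isUnit.mul_right_cancel h1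
  have h3 := S.σ_one (S.τ 1 h)
  rw [← h2] at h3
  exact Units.ext ((S.τ 1 1).isUnit.mul_left_cancel h3).symm

theorem σ_τ_one (g : Q) : S.σ g (S.τ 1 1) = S.τ g 1 := by
  have h1 := S.cocycle g 1 1
  simp only [mul_one] at h1
  exact ((S.τ g 1).isUnit.mul_right_cancel h1).symm

theorem mul_assoc' (a b c : Q →₀ R) : S.mul (S.mul a b) c = S.mul a (S.mul b c) := by
  induction a using Finsupp.induction_linear with
  | zero => simp only [zero_mul']
  | add a a' h h' => simp only [add_mul', h, h']
  | single g r =>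
    induction b using Finsupp.induction_linear with
    | zero => simp only [zero_mul', mul_zero']
    | add a a' h h' => simp only [add_mul', mul_add', h, h']
    | single h s =>
      induction c using Finsupp.induction_linear with
      | zero => simp only [mul_zero']
      | add a a' h h' => simp only [mul_add', h, h']
      | single k t =>
        simp only [mul_single_single, map_mul, mul_assoc]
        rw [← S.cocycle, ← mul_assoc (S.σ g (S.σ h t)), S.action]
        simp only [mul_assoc]

/-- The identity `τ(1, 1)⁻¹ u_1` of the crossed product. -/
def one : Q →₀ R := Finsupp.single 1 ((S.τ 1 1)⁻¹ : Rˣ)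

theorem one_mul' (a : Q →₀ R) : S.mul S.one a = a := by
  induction a using Finsupp.induction_linear with
  | zero => simp only [mul_zero']
  | add a a' h h' => simp only [mul_add', h, h']
  | single g r =>
    rw [one, mul_single_single, S.τ_one_left g, one_mul, mul_assoc, S.σ_one, ← mul_assoc,
      Units.inv_mul, one_mul]

theorem mul_one' (a : Q →₀ R) : S.mul a S.one = a := by
  induction a using Finsupp.induction_linear with
  | zero => simp only [zero_mul']
  | add a a' h h' => simp only [add_mul', h, h']
  | single g r =>
    rw [one, mul_single_single, ← S.σ_τ_one, mul_one, mul_assoc, ← map_mul, Units.inv_mul,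
      map_one, mul_one]

end CrossedSystem

/-- The crossed product `R *^σ_τ Q`: the free left `R`-module with basis `u_g`, `g ∈ Q`, with
multiplication determined by `u_g r = σ_g(r) u_g` and `u_g u_h = τ(g, h) u_{gh}`. -/
def CrossedProduct {R : Type v} [Ring R] {Q : Type w} [Group Q] (_S : CrossedSystem R Q) :
    Type (max v w) := Q →₀ R

instance {R : Type v} [Ring R] {Q : Type w} [Group Q] (S : CrossedSystem R Q) :
    AddCommGroup (CrossedProduct S) := inferInstanceAs (AddCommGroup (Q →₀ R))

instance {R : Type v} [Ring R] {Q : Type w} [Group Q] (S : CrossedSystem R Q) :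
    Ring (CrossedProduct S) where
  mul := S.mul
  one := S.one
  left_distrib := S.mul_add'
  right_distrib := S.add_mul'
  zero_mul := S.zero_mul'
  mul_zero := S.mul_zero'
  mul_assoc := S.mul_assoc'
  one_mul := S.one_mul'
  mul_one := S.mul_one'
  zsmul := fun m a => m • a
  zsmul_zero' := SubNegMonoid.zsmul_zero'
  zsmul_succ' := SubNegMonoid.zsmul_succ'
  zsmul_neg' := SubNegMonoid.zsmul_neg'
  neg_add_cancel := neg_add_cancel
  sub_eq_add_neg := sub_eq_add_neg

/-! ### The iterated matrix ring over crossed products -/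

section Iterated

variable {G : Type u} [Group G] [Finite G]

/-- Let `L ≤ C` be subgroups of `G`, let `η` be an isomorphism from the component `ℚL e_ℚ(θ^L)` to
a ring `R`, and let `T` choose a representative of each coset in `C / L`. The crossed system `S`
on `R` is the one transported through `η` from the component: the action of `q` is conjugation by
`T q`, i.e. `η ∘ (a ↦ T q · a · (T q)⁻¹) ∘ η⁻¹`, and the twisting is `η (g e_ℚ(θ^L))`, where
`g ∈ L` is the element with `T p · T q = g · T (p q)`. -/
structure IsConjSystem {H : Subgroup G} (θ : H →* ℂˣ) (L C : Subgroup G)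
    [(L.subgroupOf C).Normal] {R : Type u} [Ring R] (η : component L θ ≃+* R)
    (T : C ⧸ L.subgroupOf C → C) (S : CrossedSystem R (C ⧸ L.subgroupOf C)) : Prop where
  section_eq : ∀ q, (T q : C ⧸ L.subgroupOf C) = q
  action : ∀ q (a : component L θ), ∃ b : component L θ,
    (b : MonoidAlgebra ℚ G) = gel (T q : G) * a * gel (T q : G)⁻¹ ∧ S.σ q (η a) = η b
  twisting : ∀ p q, ∃ g ∈ L, (T p * T q : G) = g * T (p * q) ∧ ∃ c : component L θ,
    (c : MonoidAlgebra ℚ G) = gel g * eInd L θ ∧ (S.τ p q : R) = η c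

/-- `IsIterated v n θ i R` says that the ring `R` is of the form
`M_{k_i}(⋯ M_{k_{n-1}}(ℚ(ξ_k) * C_{n-1}/H_n) ⋯ * C_i/H_{i+1})`, where `H_j` is the first entry
of `v j`, `k = [H : K]` with `K = ker θ`, `C_j = Cen_{H_j}(e(H_{j+1}, H, K))`,
`k_j = [H_j : Cen_{H_j}(e_ℚ(θ^{H_{j+1}}))]`, and the action and twisting at stage `j` are
transported from `ℚH_{j+1} e_ℚ(θ^{H_{j+1}})` to the coefficient ring through some isomorphism
between these two rings, for some choice of coset representatives.
(The `ULift` only moves `ℚ(ξ_k)` to the universe of `G`.) -/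
inductive IsIterated (v : ℕ → LinTriple G) (n : ℕ) {H : Subgroup G} (θ : H →* ℂˣ) :
    ℕ → (R : Type u) → Ring R → Prop
  | base : IsIterated v n θ n (ULift.{u} (CyclotomicField ((kerChar θ).relIndex H) ℚ)) inferInstance
  | step (i : ℕ) (R : Type u) (inst : Ring R) (hi : 1 ≤ i) (hin : i < n)
      (hR : IsIterated v n θ (i + 1) R inst)
      (hN : ((v (i + 1)).H.subgroupOf
        (cen (v i).H (eSum (v (i + 1)).H H (kerChar θ)))).Normal)
      (η : component (v (i + 1)).H θ ≃+* R)
      (T : cen (v i).H (eSum (v (i + 1)).H H (kerChar θ)) ⧸ (v (i + 1)).H.subgroupOf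
        (cen (v i).H (eSum (v (i + 1)).H H (kerChar θ))) →
          cen (v i).H (eSum (v (i + 1)).H H (kerChar θ)))
      (S : CrossedSystem R (cen (v i).H (eSum (v (i + 1)).H H (kerChar θ)) ⧸
        (v (i + 1)).H.subgroupOf (cen (v i).H (eSum (v (i + 1)).H H (kerChar θ)))))
      (hS : IsConjSystem θ (v (i + 1)).H
        (cen (v i).H (eSum (v (i + 1)).H H (kerChar θ))) η T S) :
      IsIterated v n θ i
        (Matrix (Fin ((cen (v i).H (eInd (v (i + 1)).H θ)).relIndex (v i).H))
          (Fin ((cen (v i).H (eInd (v (i + 1)).H θ)).relIndex (v i).H)) (CrossedProduct S))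
        inferInstance

end Iterated

end

/-! Write `e_i` for `e_ℚ(θ^{H_i})`. The algebra `ℚH e_ℚ(θ)` of the leaf is the field `ℚ(θ) =
ℚ(ξ_k)`, and each edge of the path expresses `ℚH_i e_i` through `ℚH_{i+1} e_{i+1}` as a matrix ring
over a crossed product.

Irreducibility enters only as Shoda's condition. It says that `ω = |H|⁻¹ ∑ θ(h) h⁻¹` satisfies `ω g
ω = 0` for `g` in `L` outside `H`. Hence `ω ℂL ω = ℂω`, and a central idempotent of `ℂL` acts on `ω`
as `0` or `1`. Over `ℂ`, `e_ℚ(θ^L)` is the sum of the idempotents of the Galois conjugates of `θ^L`.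
Over `ℚ` it is a nonzero multiple of the sum of the `L`-conjugates of `e_ℚ(θ)`, the latter being the
trace of `ω`. Both descriptions together show that `e_ℚ(θ^L)` is a primitive central idempotent of
`ℚL` (`central_idempotent_mul_eInd`).

Along an edge, `H_{i+1}` is the inertia group in `H_i` of a linear character `φ` of the normal
subgroup `A_{i+1}`, and `θ` extends `φ`. An `H_i`-conjugate of `e_ℚ(φ)` equals it or is orthogonal
to it, and `e_{i+1}` lies below `e_ℚ(φ)`. It follows that the `H_i`-conjugates of `e_{i+1}` are
equal or orthogonal too, and that the centralizer `C_i` of `e_{i+1}` normalizes `H_{i+1}`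
(`isCliffordStep_inertia`). So `e_i` is a sum of `k_i` orthogonal conjugates of `e_{i+1}`
(`exists_eInd_eq_sum`), which makes `ℚH_i e_i` a matrix ring of size `k_i` over the corner `e_{i+1}
ℚH_i e_{i+1}`. The corner is spanned over `ℚH_{i+1} e_{i+1}` by coset representatives of `C_i /
H_{i+1}`, so it is the crossed product (`exists_crossed_hom`).

The centralizers in the theorem are matched by `ε(H, K) = e_ℚ(θ)` (`eps_kerChar`), which makes `e(L,
H, K)` a nonzero multiple of `e_ℚ(θ^L)`. At the last edge `H` is normal in `H_{n-1}`, and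
centralizing `e_ℚ(θ)` amounts to normalizing `K`. -/

noncomputable section

/-! ### Group algebras over a field and the idempotent of a linear character -/

section LinearIdempotent

open MonoidAlgebra

variable {G : Type u} [Group G] {k : Type v} [Field k]

/-- `kL` as a subalgebra of `kG`. -/
def subAlgOver (k : Type v) [Field k] (L : Subgroup G) : Subalgebra k (MonoidAlgebra k G) :=
  (mapDomainAlgHom k k L.subtype).range

theorem single_mem_subAlgOver {L : Subgroup G} {g : G} (hg : g ∈ L) (r : k) :
    single g r ∈ subAlgOver k L :=
  ⟨single ⟨g, hg⟩ r, by simp [mapDomainAlgHom]⟩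

theorem subAlgOver_induction {L : Subgroup G} {p : MonoidAlgebra k G → Prop} (h0 : p 0)
    (hadd : ∀ a b, p a → p b → p (a + b)) (hs : ∀ g ∈ L, ∀ r, p (single g r))
    {a : MonoidAlgebra k G} (ha : a ∈ subAlgOver k L) : p a := by
  obtain ⟨b, rfl⟩ := ha
  induction b using MonoidAlgebra.induction_linear with
  | zero => simpa using h0
  | add x y hx hy => rw [map_add]; exact hadd _ _ hx hy
  | single g r => simpa [mapDomainAlgHom] using hs g g.2 r

theorem subAlgOver_mono {L M : Subgroup G} (h : L ≤ M) : subAlgOver k L ≤ subAlgOver k M := by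
  intro a ha
  refine subAlgOver_induction (zero_mem _) (fun _ _ => add_mem) (fun g hg r => ?_) ha
  exact single_mem_subAlgOver (h hg) r

theorem conj_mem_subAlgOver {L : Subgroup G} {g : G} (hg : ∀ x ∈ L, g * x * g⁻¹ ∈ L)
    {a : MonoidAlgebra k G} (ha : a ∈ subAlgOver k L) :
    single g 1 * a * single g⁻¹ 1 ∈ subAlgOver k L := by
  refine subAlgOver_induction (p := fun a => single g 1 * a * single g⁻¹ 1 ∈ subAlgOver k L)
    (by simp) (fun a b ha hb => ?_) (fun x hx r => ?_) ha
  · rw [mul_add, add_mul]; exact add_mem ha hb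
  · rw [single_mul_single, single_mul_single]
    exact single_mem_subAlgOver (hg x hx) _

theorem single_mul_single_inv (g : G) : single g (1 : k) * single g⁻¹ 1 = 1 := by
  simp [single_mul_single, one_def]

theorem single_inv_mul_single (g : G) : single g⁻¹ (1 : k) * single g 1 = 1 := by
  simp [single_mul_single, one_def]

theorem commute_of_mem_subAlgOver {L : Subgroup G} {a z : MonoidAlgebra k G}
    (ha : a ∈ subAlgOver k L) (hz : ∀ g ∈ L, Commute (single g (1 : k)) z) : Commute a z := by
  refine subAlgOver_induction (p := fun a => Commute a z) (Commute.zero_left _)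
    (fun a b ha hb => ha.add_left hb) (fun g hg r => ?_) ha
  have : single g r = r • single g (1 : k) := by simp
  rw [this]
  exact (hz g hg).smul_left r

/-- The idempotent `|H|⁻¹ ∑_{h ∈ H} ϑ(h) h⁻¹` of a linear character `ϑ` of `H ≤ G`. -/
def omega {H : Subgroup G} (ϑ : H →* k) : MonoidAlgebra k G :=
  (Nat.card H : k)⁻¹ • ∑ᶠ h : H, single (h : G)⁻¹ (ϑ h)

open Classical in
/-- A linear character extended by zero. -/
def extHom {H : Subgroup G} (ϑ : H →* k) (g : G) : k := if h : g ∈ H then ϑ ⟨g, h⟩ else 0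

theorem extHom_of_mem {H : Subgroup G} (ϑ : H →* k) {g : G} (hg : g ∈ H) :
    extHom ϑ g = ϑ ⟨g, hg⟩ := dif_pos hg

theorem extHom_of_notMem {H : Subgroup G} (ϑ : H →* k) {g : G} (hg : g ∉ H) :
    extHom ϑ g = 0 := dif_neg hg

/-- The condition of Shoda's theorem for the irreducibility of `ϑ^L`. -/
def ShodaCond {H : Subgroup G} (L : Subgroup G) (ϑ : H →* k) : Prop :=
  ∀ g ∈ L, g ∉ H → ∃ x y : H, g * x = y * g ∧ ϑ x ≠ ϑ y

variable [Finite G]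

theorem coeff_omega {H : Subgroup G} (ϑ : H →* k) (g : G) :
    (omega ϑ).coeff g = (Nat.card H : k)⁻¹ * extHom ϑ g⁻¹ := by
  classical
  have := Fintype.ofFinite H
  rw [omega, finsum_eq_sum_of_fintype, coeff_smul_apply, smul_eq_mul, coeff_sum,
    Finsupp.finsetSum_apply]
  congr 1
  simp only [coeff_single, Finsupp.single_apply]
  by_cases hg : g⁻¹ ∈ H
  · rw [extHom_of_mem ϑ hg, Finset.sum_eq_single (⟨g⁻¹, hg⟩ : H)]
    · simp
    · rintro b - hb
      rw [if_neg]
      rintro rfl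
      exact hb (by simp)
    · simp
  · rw [extHom_of_notMem ϑ hg, Finset.sum_eq_zero]
    rintro b -
    rw [if_neg]
    rintro rfl
    exact hg (by simp)

theorem omega_mem {H : Subgroup G} (ϑ : H →* k) : omega ϑ ∈ subAlgOver k H := by
  have := Fintype.ofFinite H
  rw [omega, finsum_eq_sum_of_fintype]
  exact Subalgebra.smul_mem _ (sum_mem fun h _ => single_mem_subAlgOver (H.inv_mem h.2) _) _

omit [Finite G] in
theorem map_inv_mul_map {H : Subgroup G} (ϑ : H →* k) (h : H) : ϑ h⁻¹ * ϑ h = 1 := by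
  rw [← map_mul, inv_mul_cancel, map_one]

theorem single_mul_omega {H : Subgroup G} (ϑ : H →* k) (h : H) :
    single (h : G) 1 * omega ϑ = ϑ h • omega ϑ := by
  have := Fintype.ofFinite H
  rw [omega, finsum_eq_sum_of_fintype, mul_smul_comm, smul_comm, Finset.mul_sum]
  congr 1
  rw [Finset.smul_sum]
  refine Fintype.sum_equiv (Equiv.mulRight h⁻¹) _ _ fun x => ?_
  simp only [Equiv.coe_mulRight, single_mul_single, one_mul, smul_single, smul_eq_mul]
  congr 1
  · simp
  · rw [map_mul, mul_left_comm, mul_comm (ϑ h), map_inv_mul_map, mul_one]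

theorem omega_mul_single {H : Subgroup G} (ϑ : H →* k) (h : H) :
    omega ϑ * single (h : G) 1 = ϑ h • omega ϑ := by
  have := Fintype.ofFinite H
  rw [omega, finsum_eq_sum_of_fintype, smul_mul_assoc, smul_comm, Finset.sum_mul]
  congr 1
  rw [Finset.smul_sum]
  refine Fintype.sum_equiv (Equiv.mulLeft h⁻¹) _ _ fun x => ?_
  simp only [Equiv.coe_mulLeft, single_mul_single, mul_one, smul_single, smul_eq_mul]
  congr 1
  · simp
  · rw [map_mul, ← mul_assoc, mul_comm (ϑ h), map_inv_mul_map, one_mul]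

/-- An element of `kH` acts on the idempotent of `ϑ` as a scalar. -/
theorem exists_mul_omega {H : Subgroup G} (ϑ : H →* k) {a : MonoidAlgebra k G}
    (ha : a ∈ subAlgOver k H) : ∃ r : k, a * omega ϑ = r • omega ϑ ∧ omega ϑ * a = r • omega ϑ := by
  refine subAlgOver_induction (p := fun a => ∃ r : k, a * omega ϑ = r • omega ϑ ∧
    omega ϑ * a = r • omega ϑ) ⟨0, by simp⟩ ?_ (fun g hg r => ⟨r * ϑ ⟨g, hg⟩, ?_⟩) ha
  · rintro a b ⟨r, h1, h2⟩ ⟨s, h3, h4⟩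
    exact ⟨r + s, by rw [add_mul, h1, h3, add_smul], by rw [mul_add, h2, h4, add_smul]⟩
  · have h : single g r = r • single g (1 : k) := by simp
    rw [h, smul_mul_assoc, mul_smul_comm, single_mul_omega ϑ ⟨g, hg⟩,
      omega_mul_single ϑ ⟨g, hg⟩, smul_smul]
    exact ⟨rfl, rfl⟩

variable [CharZero k]

omit [Finite G] in
theorem natCard_ne_zero (k : Type v) [Field k] [CharZero k] (H : Subgroup G) [Finite H] :
    (Nat.card H : k) ≠ 0 :=
  Nat.cast_ne_zero.2 Nat.card_pos.ne'

/-- If every `h ∈ B` acts on `a` as the scalar `ϕ h`, then the idempotent of `ϕ` fixes `a`. -/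
theorem omega_mul_of_forall {B : Subgroup G} (ϕ : B →* k) {a : MonoidAlgebra k G}
    (h : ∀ b : B, single (b : G) 1 * a = ϕ b • a) : omega ϕ * a = a := by
  have := Fintype.ofFinite B
  have h1 : ∀ b : B, single (b : G)⁻¹ (ϕ b) * a = a := fun b => by
    have : single (b : G)⁻¹ (ϕ b) = ϕ b • single ((b⁻¹ : B) : G) (1 : k) := by simp
    rw [this, smul_mul_assoc, h, smul_smul, mul_comm, map_inv_mul_map, one_smul]
  rw [omega, finsum_eq_sum_of_fintype, smul_mul_assoc, Finset.sum_mul,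
    Finset.sum_congr rfl fun b _ => h1 b, Finset.sum_const, Finset.card_univ,
    ← Nat.card_eq_fintype_card, ← Nat.cast_smul_eq_nsmul k, smul_smul,
    inv_mul_cancel₀ (natCard_ne_zero k B), one_smul]

theorem omega_mul_self {H : Subgroup G} (ϑ : H →* k) : omega ϑ * omega ϑ = omega ϑ :=
  omega_mul_of_forall ϑ (single_mul_omega ϑ)

theorem omega_ne_zero {H : Subgroup G} (ϑ : H →* k) : omega ϑ ≠ 0 := by
  intro h
  have := coeff_omega ϑ 1
  rw [h, inv_one, extHom_of_mem ϑ H.one_mem] at this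
  have h1 : ϑ ⟨1, H.one_mem⟩ = 1 := map_one ϑ
  rw [h1] at this
  simp only [coeff_zero, Finsupp.coe_zero, Pi.zero_apply, mul_one] at this
  exact inv_ne_zero (natCard_ne_zero k H) this.symm

omit [CharZero k] in
/-- Shoda's condition makes the idempotent of `ϑ` primitive in `kL`. -/
theorem omega_mul_single_mul_omega {H L : Subgroup G} {ϑ : H →* k} (hS : ShodaCond L ϑ) {g : G}
    (hg : g ∈ L) (hgH : g ∉ H) : omega ϑ * single g 1 * omega ϑ = 0 := by
  obtain ⟨x, y, hxy, hne⟩ := hS g hg hgH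
  -- The element `ω (g x) ω = ω (y g) ω` is both `ϑ x` and `ϑ y` times `ω g ω`.
  have h1 : omega ϑ * single (g * x) 1 * omega ϑ = ϑ x • (omega ϑ * single g 1 * omega ϑ) := by
    rw [← one_mul (1 : k), ← single_mul_single, one_mul, ← mul_assoc, mul_assoc (_ * _),
      single_mul_omega, mul_smul_comm]
  have h2 : omega ϑ * single (y * g) 1 * omega ϑ = ϑ y • (omega ϑ * single g 1 * omega ϑ) := by
    rw [← one_mul (1 : k), ← single_mul_single, one_mul, ← mul_assoc,
      omega_mul_single, smul_mul_assoc, smul_mul_assoc]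
  rw [hxy, h2, ← sub_eq_zero, ← sub_smul] at h1
  exact (smul_eq_zero.1 h1).resolve_left (sub_ne_zero.2 hne.symm)

/-- Elements of `H` act on `ω` through `ϑ`, and the rest of `L` contributes zero by Shoda's
condition. The one-dimensional corner plays the role of irreducibility of `ϑ^L`. -/
theorem exists_omega_mul_mul_omega {H L : Subgroup G} {ϑ : H →* k} (hS : ShodaCond L ϑ)
    {z : MonoidAlgebra k G} (hz : z ∈ subAlgOver k L) :
    ∃ r : k, omega ϑ * z * omega ϑ = r • omega ϑ := by
  refine subAlgOver_induction (p := fun z => ∃ r : k, omega ϑ * z * omega ϑ = r • omega ϑ)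
    ⟨0, by simp⟩ ?_ (fun g hg r => ?_) hz
  · rintro a b ⟨r, h1⟩ ⟨s, h2⟩
    exact ⟨r + s, by rw [mul_add, add_mul, h1, h2, add_smul]⟩
  · have h : single g r = r • single g (1 : k) := by simp
    rw [h, mul_smul_comm, smul_mul_assoc]
    by_cases hgH : g ∈ H
    · refine ⟨r * ϑ ⟨g, hgH⟩, ?_⟩
      rw [mul_assoc, single_mul_omega ϑ ⟨g, hgH⟩, mul_smul_comm, omega_mul_self, smul_smul]
    · exact ⟨0, by rw [omega_mul_single_mul_omega hS hg hgH]; simp⟩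

/-- A central element of `kL` acts on the idempotent of `ϑ` as a scalar. -/
theorem exists_central_mul_omega {H L : Subgroup G} {ϑ : H →* k} (hHL : H ≤ L)
    (hS : ShodaCond L ϑ) {z : MonoidAlgebra k G} (hz : z ∈ subAlgOver k L)
    (hc : ∀ g ∈ L, Commute (single g (1 : k)) z) : ∃ r : k, z * omega ϑ = r • omega ϑ := by
  obtain ⟨r, hr⟩ := exists_omega_mul_mul_omega hS hz
  refine ⟨r, ?_⟩
  have := commute_of_mem_subAlgOver (subAlgOver_mono hHL (omega_mem ϑ)) hc
  rw [← hr, this.eq, mul_assoc, omega_mul_self]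

/-- The scalar by which an idempotent acts satisfies `r² = r` in a field. -/
theorem central_idempotent_mul_omega {H L : Subgroup G} {ϑ : H →* k} (hHL : H ≤ L)
    (hS : ShodaCond L ϑ) {z : MonoidAlgebra k G} (hz : z ∈ subAlgOver k L)
    (hc : ∀ g ∈ L, Commute (single g (1 : k)) z) (hi : z * z = z) :
    z * omega ϑ = 0 ∨ z * omega ϑ = omega ϑ := by
  obtain ⟨r, hr⟩ := exists_central_mul_omega hHL hS hz hc
  have h1 : (r * r - r) • omega ϑ = 0 := by
    rw [sub_smul, mul_smul, ← hr, ← mul_smul_comm, ← hr, ← mul_assoc, hi, sub_self]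
  have h2 : r * (r - 1) = 0 := by
    rw [mul_sub, mul_one]; exact (smul_eq_zero.1 h1).resolve_right (omega_ne_zero ϑ)
  rcases mul_eq_zero.1 h2 with h | h
  · left; rw [hr, h, zero_smul]
  · right; rw [hr, sub_eq_zero.1 h, one_smul]

/-- The sum of all conjugates `x a x⁻¹`, `x ∈ L`. -/
def conjSum (L : Subgroup G) (a : MonoidAlgebra k G) : MonoidAlgebra k G :=
  ∑ᶠ x : L, single (x : G) 1 * a * single (x : G)⁻¹ 1

omit [CharZero k] in
theorem coeff_conjSum (L : Subgroup G) (a : MonoidAlgebra k G) (g : G) :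
    (conjSum L a).coeff g = ∑ᶠ x : L, a.coeff ((x : G)⁻¹ * g * x) := by
  have := Fintype.ofFinite L
  rw [conjSum, finsum_eq_sum_of_fintype, finsum_eq_sum_of_fintype, coeff_sum,
    Finsupp.finsetSum_apply]
  refine Finset.sum_congr rfl fun x _ => ?_
  rw [coeff_mul_single_apply, coeff_single_mul_apply]
  simp [mul_assoc]

omit [CharZero k] in
theorem commute_conjSum (L : Subgroup G) (a : MonoidAlgebra k G) {g : G} (hg : g ∈ L) :
    Commute (single g (1 : k)) (conjSum L a) := by
  have := Fintype.ofFinite L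
  rw [conjSum, finsum_eq_sum_of_fintype, Commute, SemiconjBy, Finset.mul_sum, Finset.sum_mul]
  refine Fintype.sum_equiv (Equiv.mulLeft ⟨g, hg⟩) _ _ fun x => ?_
  simp [mul_assoc, single_mul_single]
  simp [← mul_assoc, single_mul_single]

omit [CharZero k] in
theorem conjSum_mem {L : Subgroup G} {a : MonoidAlgebra k G} (ha : a ∈ subAlgOver k L) :
    conjSum L a ∈ subAlgOver k L := by
  have := Fintype.ofFinite L
  rw [conjSum, finsum_eq_sum_of_fintype]
  exact sum_mem fun x _ =>
    conj_mem_subAlgOver (fun y hy => L.mul_mem (L.mul_mem x.2 hy) (L.inv_mem x.2)) ha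

/-- The idempotent of the induced character `ϑ^L`. -/
def omegaInd {H : Subgroup G} (L : Subgroup G) (ϑ : H →* k) : MonoidAlgebra k G :=
  (Nat.card H : k)⁻¹ • conjSum L (omega ϑ)

omit [CharZero k] in
theorem omegaInd_mem {H L : Subgroup G} (hHL : H ≤ L) (ϑ : H →* k) :
    omegaInd L ϑ ∈ subAlgOver k L :=
  Subalgebra.smul_mem _ (conjSum_mem (subAlgOver_mono hHL (omega_mem ϑ))) _

omit [CharZero k] in
theorem commute_omegaInd {H L : Subgroup G} (ϑ : H →* k) {g : G} (hg : g ∈ L) :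
    Commute (single g (1 : k)) (omegaInd L ϑ) :=
  (commute_conjSum L _ hg).smul_right _

/-- Among the products `x ω x⁻¹ ω`, those with `x` outside `H` vanish and the `|H|` others equal
`ω`; this is the reason for the factor `|H|⁻¹` in `omegaInd`. -/
theorem omegaInd_mul_omega {H L : Subgroup G} (hHL : H ≤ L) {ϑ : H →* k} (hS : ShodaCond L ϑ) :
    omegaInd L ϑ * omega ϑ = omega ϑ := by
  classical
  have := Fintype.ofFinite L
  have := Fintype.ofFinite H
  have h1 : ∀ x : L, single (x : G) 1 * omega ϑ * single (x : G)⁻¹ 1 * omega ϑ =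
      if (x : G) ∈ H then omega ϑ else 0 := by
    intro x
    split_ifs with hx
    · have h2 := omega_mul_single ϑ ⟨x, hx⟩⁻¹
      have h3 := single_mul_omega ϑ ⟨x, hx⟩
      simp only [Subgroup.coe_inv] at h2 h3
      rw [h3, smul_mul_assoc, h2, smul_smul, mul_comm, map_inv_mul_map, one_smul, omega_mul_self]
    · rw [mul_assoc, mul_assoc, ← mul_assoc (omega ϑ),
        omega_mul_single_mul_omega hS (L.inv_mem x.2) (by simpa using hx), mul_zero]
  rw [omegaInd, conjSum, finsum_eq_sum_of_fintype, smul_mul_assoc, Finset.sum_mul,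
    Finset.sum_congr rfl fun x _ => h1 x, ← Finset.sum_filter, Finset.sum_const]
  have h2 : (Finset.univ.filter fun x : L => (x : G) ∈ H).card = Nat.card H := by
    rw [← Fintype.card_subtype, ← Nat.card_eq_fintype_card]
    exact Nat.card_congr (Subgroup.subgroupOfEquivOfLe hHL).toEquiv
  rw [h2, ← Nat.cast_smul_eq_nsmul k, smul_smul, inv_mul_cancel₀ (natCard_ne_zero k H), one_smul]

omit [CharZero k] in
/-- If a central element of `kL` acts on the idempotent of `ϑ` as a scalar, then it acts on the
idempotent of `ϑ^L` as the same scalar. -/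
theorem central_mul_omegaInd {H L : Subgroup G} {ϑ : H →* k} {z : MonoidAlgebra k G}
    (hc : ∀ g ∈ L, Commute (single g (1 : k)) z) {r : k} (hr : z * omega ϑ = r • omega ϑ) :
    z * omegaInd L ϑ = r • omegaInd L ϑ := by
  have := Fintype.ofFinite L
  rw [omegaInd, conjSum, finsum_eq_sum_of_fintype, mul_smul_comm, smul_comm, Finset.mul_sum]
  congr 1
  rw [Finset.smul_sum]
  refine Finset.sum_congr rfl fun x _ => ?_
  rw [← mul_assoc, ← mul_assoc, ← (hc x x.2).eq, mul_assoc (single (x : G) (1 : k)), hr,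
    mul_smul_comm, smul_mul_assoc]

theorem omegaInd_mul_self {H L : Subgroup G} (hHL : H ≤ L) {ϑ : H →* k} (hS : ShodaCond L ϑ) :
    omegaInd L ϑ * omegaInd L ϑ = omegaInd L ϑ := by
  have := central_mul_omegaInd (fun g hg => commute_omegaInd ϑ hg) (r := 1)
    (by rw [omegaInd_mul_omega hHL hS, one_smul])
  rwa [one_smul] at this

/-- Each of the two central idempotents acts as `0` or `1` on the linear idempotent underlying the
other. If both act as `1`, each absorbs the other and they coincide; if only the first does, then `ω
= 0`, which is absurd. -/
theorem omegaInd_mul_omega_eq_zero_or {H L : Subgroup G} (hHL : H ≤ L) {ϑ ϑ' : H →* k}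
    (hS : ShodaCond L ϑ) (hS' : ShodaCond L ϑ') :
    omegaInd L ϑ' * omega ϑ = 0 ∨ omegaInd L ϑ' = omegaInd L ϑ := by
  have c1 : ∀ g ∈ L, Commute (single g (1 : k)) (omegaInd L ϑ) := fun g hg =>
    commute_omegaInd ϑ hg
  have c2 : ∀ g ∈ L, Commute (single g (1 : k)) (omegaInd L ϑ') := fun g hg =>
    commute_omegaInd ϑ' hg
  rcases central_idempotent_mul_omega hHL hS (omegaInd_mem hHL ϑ') c2
    (omegaInd_mul_self hHL hS') with h | h
  · exact Or.inl h
  have h1 : omegaInd L ϑ' * omegaInd L ϑ = omegaInd L ϑ := by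
    simpa using central_mul_omegaInd c2 (r := 1) (by simpa using h)
  have hcomm := commute_of_mem_subAlgOver (omegaInd_mem hHL ϑ') c1
  rcases central_idempotent_mul_omega hHL hS' (omegaInd_mem hHL ϑ) c1
    (omegaInd_mul_self hHL hS) with h' | h'
  · have h2 : omegaInd L ϑ * omegaInd L ϑ' = 0 := by
      simpa using central_mul_omegaInd c1 (r := 0) (by simpa using h')
    left
    rw [← hcomm.eq, h1] at h2
    have := omegaInd_mul_omega hHL hS
    rw [h2, zero_mul] at this
    exact absurd this.symm (omega_ne_zero ϑ)
  · have h2 : omegaInd L ϑ * omegaInd L ϑ' = omegaInd L ϑ' := by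
      simpa using central_mul_omegaInd c1 (r := 1) (by simpa using h')
    right
    rw [← h2, ← hcomm.eq, h1]

end LinearIdempotent

/-! ### Change of coefficients -/

section ChangeOfCoefficients

open MonoidAlgebra

variable {G : Type u} [Group G] {k : Type v} [Field k] {k' : Type w} [Field k']

theorem extHom_comp {H : Subgroup G} (f : k →+* k') (ϑ : H →* k) (g : G) :
    extHom ((f : k →* k').comp ϑ) g = f (extHom ϑ g) := by
  by_cases hg : g ∈ H
  · rw [extHom_of_mem _ hg, extHom_of_mem _ hg]; rfl
  · rw [extHom_of_notMem _ hg, extHom_of_notMem _ hg, map_zero]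

theorem mapRingHom_omega [Finite G] {H : Subgroup G} (f : k →+* k') (ϑ : H →* k) :
    mapRingHom G f (omega ϑ) = omega ((f : k →* k').comp ϑ) := by
  ext g
  rw [coeff_omega, extHom_comp]
  simp [mapRingHom, coeff_omega]

theorem mapRingHom_injective (f : k →+* k') : Function.Injective (mapRingHom G f) := by
  intro a b h
  ext g
  have := DFunLike.congr_fun (congrArg coeff h) g
  exact f.injective (by simpa [mapRingHom] using this)

theorem mapRingHom_mem {L : Subgroup G} (f : k →+* k') {a : MonoidAlgebra k G}
    (ha : a ∈ subAlgOver k L) : mapRingHom G f a ∈ subAlgOver k' L := by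
  refine subAlgOver_induction (p := fun a => mapRingHom G f a ∈ subAlgOver k' L)
    (by simp) (fun a b ha hb => ?_) (fun g hg r => ?_) ha
  · rw [map_add]; exact add_mem ha hb
  · rw [mapRingHom_single]; exact single_mem_subAlgOver hg _

theorem ShodaCond.comp {H L : Subgroup G} {ϑ : H →* k} (h : ShodaCond L ϑ) (f : k →+* k') :
    ShodaCond L ((f : k →* k').comp ϑ) := by
  intro g hg hgH
  obtain ⟨x, y, hxy, hne⟩ := h g hg hgH
  exact ⟨x, y, hxy, fun h => hne (f.injective h)⟩

variable [Algebra ℚ k]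

variable (G k) in
/-- The inclusion `ℚG → kG`. -/
abbrev baseChange : MonoidAlgebra ℚ G →+* MonoidAlgebra k G := mapRingHom G (algebraMap ℚ k)

theorem baseChange_gel (g : G) : baseChange G k (gel g) = single g 1 := by
  simp [gel, mapRingHom_single]

theorem mapRingHom_baseChange [Algebra ℚ k'] (f : k →ₐ[ℚ] k') (a : MonoidAlgebra ℚ G) :
    mapRingHom G (f : k →+* k') (baseChange G k a) = baseChange G k' a := by
  ext g
  simp [mapRingHom]

/-- A `ℚ`-linear functional, applied to the coefficients, is `ℚG`-linear. -/
theorem map_baseChange_mul (t : k →ₗ[ℚ] ℚ) (z : MonoidAlgebra ℚ G) (a : MonoidAlgebra k G) :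
    MonoidAlgebra.map t.toAddMonoidHom (baseChange G k z * a) =
      z * MonoidAlgebra.map t.toAddMonoidHom a := by
  induction z using MonoidAlgebra.induction_linear with
  | zero => simp
  | add x y hx hy => rw [map_add, add_mul, MonoidAlgebra.map_add, hx, hy, add_mul]
  | single g r =>
    induction a using MonoidAlgebra.induction_linear with
    | zero => simp
    | add x y hx hy => rw [mul_add, MonoidAlgebra.map_add, hx, hy, MonoidAlgebra.map_add, mul_add]
    | single g' r' =>
      simp only [mapRingHom_single, single_mul_single, map_single]
      congr 1
      change t (algebraMap ℚ k r * r') = r * t r'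
      rw [← Algebra.smul_def, map_smul, smul_eq_mul]

end ChangeOfCoefficients

/-! ### The idempotents `e_ℚ(θ^L)` -/

section RationalIdempotent

open MonoidAlgebra

variable {G : Type u} [Group G] {H : Subgroup G} (θ : H →* ℂˣ)

/-- A linear character as a complex valued homomorphism. -/
abbrev charHom : H →* ℂ := (Units.coeHom ℂ).comp θ

theorem extChar_of_mem {g : G} (hg : g ∈ H) : extChar θ g = θ ⟨g, hg⟩ := dif_pos hg

theorem extChar_of_notMem {g : G} (hg : g ∉ H) : extChar θ g = 0 := dif_neg hg

theorem extChar_one : extChar θ 1 = 1 := by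
  rw [extChar_of_mem θ H.one_mem]
  exact congrArg Units.val (map_one θ)

/-- The field `ℚ(θ)`. -/
abbrev linField : IntermediateField ℚ ℂ := charField (extChar θ)

theorem extChar_mem (g : G) : extChar θ g ∈ linField θ :=
  IntermediateField.subset_adjoin _ _ ⟨g, rfl⟩

/-- A linear character as a homomorphism to its own field of values. -/
def charFieldHom : H →* linField θ where
  toFun h := ⟨extChar θ h, extChar_mem θ h⟩
  map_one' := Subtype.ext (extChar_one θ)
  map_mul' x y := Subtype.ext (by
    change extChar θ (x * y) = extChar θ x * extChar θ y
    rw [extChar_of_mem θ x.2, extChar_of_mem θ y.2, extChar_of_mem θ (H.mul_mem x.2 y.2)]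
    exact congrArg Units.val (map_mul θ x y))

theorem coe_charFieldHom (h : H) : (charFieldHom θ h : ℂ) = θ h := extChar_of_mem θ h.2

theorem coe_extHom_charFieldHom (g : G) : ((extHom (charFieldHom θ) g : linField θ) : ℂ) = extChar θ g := by
  by_cases hg : g ∈ H
  · rw [extHom_of_mem _ hg]; rfl
  · rw [extHom_of_notMem _ hg, extChar_of_notMem _ hg]; rfl

theorem extHom_charFieldHom (g : G) :
    extHom (charFieldHom θ) g = ⟨extChar θ g, extChar_mem θ g⟩ :=
  Subtype.ext (coe_extHom_charFieldHom θ g)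

/-- The inclusion of `ℚ(χ)` in `ℂ`. -/
def fieldIncl (χ : G → ℂ) : charField χ →ₐ[ℚ] ℂ := (charField χ).val

theorem fieldIncl_comp_charFieldHom :
    ((fieldIncl (extChar θ) : linField θ →+* ℂ) : linField θ →* ℂ).comp (charFieldHom θ) =
      charHom θ :=
  MonoidHom.ext fun h => coe_charFieldHom θ h

theorem shodaCond_charFieldHom {L : Subgroup G} (h : ShodaCond L (charHom θ)) :
    ShodaCond L (charFieldHom θ) := by
  intro g hg hgH
  obtain ⟨x, y, hxy, hne⟩ := h g hg hgH
  refine ⟨x, y, hxy, fun e => hne ?_⟩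
  have := congrArg (Subtype.val) e
  rwa [coe_charFieldHom, coe_charFieldHom] at this

variable [Finite G]

theorem isIntegral_extChar (g : G) : IsIntegral ℚ (extChar θ g) := by
  by_cases hg : g ∈ H
  · rw [extChar_of_mem _ hg]
    refine IsIntegral.of_pow (Nat.card_pos (α := H)) ?_
    rw [← Units.val_pow_eq_pow_val, ← map_pow, pow_card_eq_one']
    simpa using isIntegral_one
  · rw [extChar_of_notMem _ hg]; exact isIntegral_zero

instance : FiniteDimensional ℚ (linField θ) := by
  have : Finite (Set.range (extChar θ)) := Set.finite_range _
  exact IntermediateField.finiteDimensional_adjoin (by rintro _ ⟨g, rfl⟩; exact isIntegral_extChar θ g)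

omit [Finite G] in
theorem indChar_eq (L : Subgroup G) (g : G) :
    indChar L θ g = (Nat.card H : ℂ)⁻¹ * ∑ᶠ x : L, extChar θ ((x : G)⁻¹ * g * x) := rfl

omit [Finite G] in
theorem indChar_of_notMem {L : Subgroup G} (hHL : H ≤ L) {g : G} (hg : g ∉ L) :
    indChar L θ g = 0 := by
  rw [indChar_eq, finsum_eq_zero_of_forall_eq_zero, mul_zero]
  intro x
  refine extChar_of_notMem θ fun h => hg ?_
  have := L.mul_mem (L.mul_mem x.2 (hHL h)) (L.inv_mem x.2)
  simpa [mul_assoc] using this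

theorem indChar_one (L : Subgroup G) :
    indChar L θ 1 = (Nat.card H : ℂ)⁻¹ * Nat.card L := by
  have := Fintype.ofFinite L
  rw [indChar_eq, finsum_eq_sum_of_fintype]
  simp [extChar_one]

theorem indChar_self : indChar H θ = extChar θ := by
  funext g
  have := Fintype.ofFinite H
  have h : ∀ x : H, extChar θ ((x : G)⁻¹ * g * x) = extChar θ g := by
    intro x
    by_cases hg : g ∈ H
    · have h1 : (x : G)⁻¹ * g * x ∈ H := H.mul_mem (H.mul_mem (H.inv_mem x.2) hg) x.2
      rw [extChar_of_mem _ hg, extChar_of_mem _ h1]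
      have : (⟨(x : G)⁻¹ * g * x, h1⟩ : H) = x⁻¹ * ⟨g, hg⟩ * x := rfl
      rw [this, map_mul, map_mul, mul_right_comm, ← map_mul, inv_mul_cancel, map_one, one_mul]
    · rw [extChar_of_notMem _ hg, extChar_of_notMem]
      intro h
      apply hg
      have := H.mul_mem (H.mul_mem x.2 h) (H.inv_mem x.2)
      simpa [mul_assoc] using this
  rw [indChar_eq, finsum_eq_sum_of_fintype, Finset.sum_congr rfl fun x _ => h x]
  simp

theorem indChar_mem (L : Subgroup G) (g : G) : indChar L θ g ∈ linField θ := by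
  have := Fintype.ofFinite L
  rw [indChar_eq, finsum_eq_sum_of_fintype]
  exact mul_mem (inv_mem (natCast_mem _ _)) (sum_mem fun x _ => extChar_mem θ _)

theorem charField_indChar_le (L : Subgroup G) : charField (indChar L θ) ≤ linField θ := by
  rw [IntermediateField.adjoin_le_iff]
  rintro _ ⟨g, rfl⟩
  exact indChar_mem θ L g

theorem coeff_eQ {L : Subgroup G} {χ : G → ℂ} (hχ : ∀ g, g ∉ L → χ g = 0) (y : G) :
    (eQ L χ).coeff y = (Nat.card L : ℚ)⁻¹ * Algebra.trace ℚ (charField χ)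
      (⟨χ 1, IntermediateField.subset_adjoin _ _ ⟨1, rfl⟩⟩ *
      ⟨χ y⁻¹, IntermediateField.subset_adjoin _ _ ⟨y⁻¹, rfl⟩⟩) := by
  classical
  have := Fintype.ofFinite L
  rw [eQ, finsum_eq_sum_of_fintype, coeff_sum, Finsupp.finsetSum_apply]
  by_cases hy : y⁻¹ ∈ L
  · rw [Finset.sum_eq_single (⟨y⁻¹, hy⟩ : L)]
    · simp [gel]
    · rintro b - hb
      have : (b : G)⁻¹ ≠ y := by rintro rfl; exact hb (by simp)
      simp [gel, this]
    · simp
  · rw [Finset.sum_eq_zero]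
    · have : (⟨χ y⁻¹, IntermediateField.subset_adjoin _ _ ⟨y⁻¹, rfl⟩⟩ : charField χ) = 0 :=
        Subtype.ext (hχ _ hy)
      rw [this, mul_zero, map_zero, mul_zero]
    · rintro b -
      have : (b : G)⁻¹ ≠ y := by rintro rfl; exact hy (by simp)
      simp [gel, this]

/-- The value of `θ^L` as an element of its field of values. -/
def indVal (L : Subgroup G) (g : G) : charField (indChar L θ) :=
  ⟨indChar L θ g, IntermediateField.subset_adjoin _ _ ⟨g, rfl⟩⟩

theorem coeff_eInd {L : Subgroup G} (hHL : H ≤ L) (y : G) :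
    (eInd L θ).coeff y = (Nat.card H : ℚ)⁻¹ *
      Algebra.trace ℚ (charField (indChar L θ)) (indVal θ L y⁻¹) := by
  rw [eInd, coeff_eQ fun g hg => indChar_of_notMem θ hHL hg]
  have h1 : (⟨indChar L θ 1, IntermediateField.subset_adjoin _ _ ⟨1, rfl⟩⟩ :
      charField (indChar L θ)) * ⟨indChar L θ y⁻¹, IntermediateField.subset_adjoin _ _ ⟨y⁻¹, rfl⟩⟩ =
      ((Nat.card H : ℚ)⁻¹ * Nat.card L) • indVal θ L y⁻¹ := by
    apply Subtype.ext
    rw [IntermediateField.coe_smul, Rat.smul_def]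
    change indChar L θ 1 * indChar L θ y⁻¹ = _ * indChar L θ y⁻¹
    rw [indChar_one]
    push_cast
    rfl
  rw [h1, map_smul, smul_eq_mul]
  have := natCard_ne_zero ℚ L
  field_simp

/-- The idempotent of a Galois conjugate of `θ^L`. -/
theorem coeff_omegaInd (L : Subgroup G) (σ : linField θ →ₐ[ℚ] ℂ) (y : G) :
    (omegaInd L (((σ : linField θ →+* ℂ) : linField θ →* ℂ).comp (charFieldHom θ))).coeff y =
      (Nat.card H : ℂ)⁻¹ * σ ⟨indChar L θ y⁻¹, indChar_mem θ L y⁻¹⟩ := by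
  have := Fintype.ofFinite L
  have h1 : (⟨indChar L θ y⁻¹, indChar_mem θ L y⁻¹⟩ : linField θ) =
      (Nat.card H : linField θ)⁻¹ * ∑ x : L, extHom (charFieldHom θ) ((x : G)⁻¹ * y⁻¹ * x) := by
    apply Subtype.ext
    simp only [indChar_eq, finsum_eq_sum_of_fintype, extHom_charFieldHom]
    simp
  rw [h1, omegaInd, coeff_smul_apply, coeff_conjSum, finsum_eq_sum_of_fintype, smul_eq_mul,
    map_mul, map_inv₀, map_natCast, map_sum]
  congr 1
  rw [Finset.mul_sum]
  refine Finset.sum_congr rfl fun x _ => ?_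
  rw [coeff_omega, extHom_comp]
  simp [mul_assoc]

theorem coeff_omegaInd_charHom (L : Subgroup G) (y : G) :
    (omegaInd L (charHom θ)).coeff y = (Nat.card H : ℂ)⁻¹ * indChar L θ y⁻¹ := by
  rw [← fieldIncl_comp_charFieldHom]
  exact coeff_omegaInd θ L (fieldIncl (extChar θ)) y

/-- Over `ℂ`, the idempotent `e_ℚ(θ^L)` fixes the idempotent of `θ`. -/
theorem baseChange_eInd_mul_omega {L : Subgroup G} (hHL : H ≤ L)
    (hS : ShodaCond L (charHom θ)) :
    baseChange G ℂ (eInd L θ) * omega (charHom θ) = omega (charHom θ) := by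
  classical
  have hle := charField_indChar_le θ L
  let _ : Algebra (charField (indChar L θ)) (linField θ) :=
    (IntermediateField.inclusion hle).toAlgebra
  have : IsScalarTower ℚ (charField (indChar L θ)) (linField θ) :=
    IsScalarTower.of_algebraMap_eq fun _ => rfl
  have : FiniteDimensional ℚ (charField (indChar L θ)) :=
    FiniteDimensional.of_injective (IntermediateField.inclusion hle).toLinearMap
      (IntermediateField.inclusion_injective hle)
  have : FiniteDimensional (charField (indChar L θ)) (linField θ) :=
    FiniteDimensional.right ℚ _ _
  -- An embedding of `ℚ(θ^L)` in `ℂ` extends to `ℚ(θ)`, so every Galois conjugate of `θ^L` is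
  -- induced from a conjugate of `θ`. One extension is chosen for each embedding, to count each
  -- conjugate of `θ^L` once.
  have hsurj : ∀ τ : charField (indChar L θ) →ₐ[ℚ] ℂ, ∃ σ : linField θ →ₐ[ℚ] ℂ,
      ∀ x, σ (algebraMap (charField (indChar L θ)) (linField θ) x) = τ x := by
    intro τ
    obtain ⟨σ, hσ⟩ := IsAlgClosed.surjective_domRestrict_of_isAlgebraic
      (K := ℚ) (L := charField (indChar L θ)) (M := ℂ) (E := linField θ) τ
    exact ⟨σ, fun x => DFunLike.congr_fun hσ x⟩
  choose σ hσ using hsurj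
  have hcoeff : ∀ τ y, (omegaInd L (((σ τ : linField θ →+* ℂ) : linField θ →* ℂ).comp
      (charFieldHom θ))).coeff y = (Nat.card H : ℂ)⁻¹ * τ (indVal θ L y⁻¹) := by
    intro τ y
    rw [coeff_omegaInd, ← hσ]
    rfl
  have hsum : baseChange G ℂ (eInd L θ) = ∑ τ : charField (indChar L θ) →ₐ[ℚ] ℂ,
      omegaInd L (((σ τ : linField θ →+* ℂ) : linField θ →* ℂ).comp (charFieldHom θ)) := by
    ext y
    rw [coeff_sum, Finsupp.finsetSum_apply, Finset.sum_congr rfl fun τ _ => hcoeff τ y,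
      ← Finset.mul_sum, ← trace_eq_sum_embeddings ℂ]
    change algebraMap ℚ ℂ ((eInd L θ).coeff y) = _
    rw [coeff_eInd θ hHL, map_mul, map_inv₀, map_natCast]
  have hSF := shodaCond_charFieldHom θ hS
  rw [hsum, Finset.sum_mul, Finset.sum_eq_single (fieldIncl (indChar L θ))]
  · have : omegaInd L (((σ (fieldIncl (indChar L θ)) : linField θ →+* ℂ) :
        linField θ →* ℂ).comp (charFieldHom θ)) = omegaInd L (charHom θ) := by
      ext y
      rw [hcoeff, coeff_omegaInd_charHom]
      rfl
    rw [this, omegaInd_mul_omega hHL hS]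
  -- A conjugate whose idempotent does not annihilate `ω` has the same idempotent as `θ^L`;
  -- comparing coefficients, `τ` fixes the values of `θ^L` and so is the inclusion.
  · rintro τ - hτ
    refine (omegaInd_mul_omega_eq_zero_or hHL hS (hSF.comp _)).resolve_right fun h => hτ ?_
    refine IntermediateField.algHom_ext_of_eq_adjoin _ rfl fun x hx => ?_
    obtain ⟨g, rfl⟩ := hx
    have h1 := hcoeff τ g⁻¹
    rw [h, coeff_omegaInd_charHom, inv_inv] at h1
    exact (mul_left_cancel₀ (inv_ne_zero (natCard_ne_zero ℂ H)) h1).symm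
  · simp

/-- The idempotent `e_ℚ(θ)` is the trace of the idempotent of `θ`. -/
theorem eInd_self_eq : eInd H θ =
    MonoidAlgebra.map (Algebra.trace ℚ (linField θ)).toAddMonoidHom (omega (charFieldHom θ)) := by
  ext y
  rw [eInd, indChar_self, coeff_eQ fun g hg => extChar_of_notMem θ hg]
  change _ = Algebra.trace ℚ (linField θ) ((omega (charFieldHom θ)).coeff y)
  rw [coeff_omega]
  have h1 : (Nat.card H : linField θ)⁻¹ * extHom (charFieldHom θ) y⁻¹ =
      (Nat.card H : ℚ)⁻¹ • ((⟨extChar θ 1, extChar_mem θ 1⟩ : linField θ) *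
        ⟨extChar θ y⁻¹, extChar_mem θ _⟩) := by
    apply Subtype.ext
    rw [extHom_charFieldHom, IntermediateField.coe_smul, Rat.smul_def]
    simp [extChar_one]
  rw [h1, map_smul, smul_eq_mul]

/-- Extension of scalars is injective. Relations are thus proved over `ℂ`, where the embeddings take
their values, and used over `ℚ(θ)`, where there is a trace to `ℚ`. -/
theorem baseChange_mul_omega_iff (z : MonoidAlgebra ℚ G) :
    baseChange G (linField θ) z * omega (charFieldHom θ) = 0 ↔
      baseChange G ℂ z * omega (charHom θ) = 0 := by
  rw [← fieldIncl_comp_charFieldHom, ← mapRingHom_omega,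
    ← mapRingHom_baseChange (fieldIncl (extChar θ)),
    ← map_mul, map_eq_zero_iff _ (mapRingHom_injective _)]

/-- Taking traces of coefficients is `ℚG`-linear, so a relation with rational `z` passes from `ω` to
its trace `e_ℚ(θ)`. -/
theorem mul_eInd_self_eq_zero {z : MonoidAlgebra ℚ G}
    (h : baseChange G (linField θ) z * omega (charFieldHom θ) = 0) : z * eInd H θ = 0 := by
  rw [eInd_self_eq, ← map_baseChange_mul, h, MonoidAlgebra.map_zero]

theorem mul_eInd_self_eq {z : MonoidAlgebra ℚ G}
    (h : baseChange G (linField θ) z * omega (charFieldHom θ) = omega (charFieldHom θ)) :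
    z * eInd H θ = eInd H θ := by
  rw [← sub_eq_zero, ← sub_one_mul]
  apply mul_eInd_self_eq_zero
  rw [map_sub, map_one, sub_one_mul, h, sub_self]

omit [Finite G] in
theorem shodaCond_self {k : Type v} [Field k] (ϑ : H →* k) : ShodaCond H ϑ :=
  fun _ h h' => absurd h h'

theorem baseChange_eInd_mul_omega_field {L : Subgroup G} (hHL : H ≤ L)
    (hS : ShodaCond L (charHom θ)) :
    baseChange G (linField θ) (eInd L θ) * omega (charFieldHom θ) = omega (charFieldHom θ) := by
  rw [← sub_eq_zero, ← sub_one_mul, ← map_one (baseChange G (linField θ)), ← map_sub,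
    baseChange_mul_omega_iff, map_sub, map_one, sub_one_mul, baseChange_eInd_mul_omega θ hHL hS,
    sub_self]

theorem eInd_mul_eInd_self {L : Subgroup G} (hHL : H ≤ L) (hS : ShodaCond L (charHom θ)) :
    eInd L θ * eInd H θ = eInd H θ :=
  mul_eInd_self_eq θ (baseChange_eInd_mul_omega_field θ hHL hS)

theorem eInd_self_ne_zero : eInd H θ ≠ 0 := by
  intro h
  have := baseChange_eInd_mul_omega θ le_rfl (shodaCond_self _)
  rw [h, map_zero, zero_mul] at this
  exact omega_ne_zero _ this.symm

/-- The idempotent `e_ℚ(θ^L)` is a multiple of the sum of the conjugates of `e_ℚ(θ)`. -/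
theorem exists_eInd_eq_smul_conjSum {L : Subgroup G} (hHL : H ≤ L) :
    ∃ c : ℚ, c ≠ 0 ∧ eInd L θ = c • conjSum L (eInd H θ) := by
  have hle := charField_indChar_le θ L
  let _ : Algebra (charField (indChar L θ)) (linField θ) :=
    (IntermediateField.inclusion hle).toAlgebra
  have : IsScalarTower ℚ (charField (indChar L θ)) (linField θ) :=
    IsScalarTower.of_algebraMap_eq fun _ => rfl
  have : FiniteDimensional ℚ (charField (indChar L θ)) :=
    FiniteDimensional.of_injective (IntermediateField.inclusion hle).toLinearMap
      (IntermediateField.inclusion_injective hle)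
  have : FiniteDimensional (charField (indChar L θ)) (linField θ) :=
    FiniteDimensional.right ℚ _ _
  have := Fintype.ofFinite L
  set d : ℚ := (Module.finrank (charField (indChar L θ)) (linField θ) : ℚ)
  have hd : d ≠ 0 := Nat.cast_ne_zero.2 Module.finrank_pos.ne'
  have htr : ∀ x, Algebra.trace ℚ (linField θ)
      (algebraMap (charField (indChar L θ)) (linField θ) x) =
      d * Algebra.trace ℚ (charField (indChar L θ)) x := by
    intro x
    rw [← Algebra.trace_trace (S := charField (indChar L θ)), Algebra.trace_algebraMap, map_nsmul,
      nsmul_eq_mul]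
  -- Summing conjugates over `L` moves the coefficients of `ω` into `ℚ(θ^L)`, where the trace from
  -- `ℚ(θ)` is `d` times the trace from `ℚ(θ^L)`; `|H|` is the denominator in the formula for the
  -- induced character.
  refine ⟨(Nat.card H * d)⁻¹, inv_ne_zero (mul_ne_zero (natCard_ne_zero ℚ H) hd), ?_⟩
  ext y
  rw [coeff_smul_apply, coeff_conjSum, finsum_eq_sum_of_fintype, coeff_eInd θ hHL]
  have h1 : ∀ x : L, (eInd H θ).coeff ((x : G)⁻¹ * y * x) =
      Algebra.trace ℚ (linField θ) ((omega (charFieldHom θ)).coeff ((x : G)⁻¹ * y * x)) := by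
    intro x; rw [eInd_self_eq]; rfl
  rw [Finset.sum_congr rfl fun x _ => h1 x, ← map_sum]
  have h2 : ∑ x : L, (omega (charFieldHom θ)).coeff ((x : G)⁻¹ * y * x) =
      algebraMap (charField (indChar L θ)) (linField θ) (indVal θ L y⁻¹) := by
    apply Subtype.ext
    change _ = indChar L θ y⁻¹
    rw [indChar_eq, finsum_eq_sum_of_fintype, Finset.mul_sum]
    simp only [coeff_omega, extHom_charFieldHom]
    simp [mul_assoc]
  rw [h2, htr, smul_eq_mul, mul_inv]
  field_simp

theorem commute_gel_eInd {L : Subgroup G} (hHL : H ≤ L) {g : G} (hg : g ∈ L) :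
    Commute (gel g) (eInd L θ) := by
  obtain ⟨c, -, hc⟩ := exists_eInd_eq_smul_conjSum θ hHL
  rw [hc]
  exact (commute_conjSum L _ hg).smul_right c

theorem eInd_mem (L : Subgroup G) : eInd L θ ∈ subAlgOver ℚ L := eQ_mem_subAlg _ _

/-- A central element which fixes `e_ℚ(θ)` fixes `e_ℚ(θ^L)`. -/
theorem central_mul_eInd {L : Subgroup G} (hHL : H ≤ L) {z : MonoidAlgebra ℚ G}
    (hc : ∀ g ∈ L, Commute (gel g) z) {r : ℚ} (hr : z * eInd H θ = r • eInd H θ) :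
    z * eInd L θ = r • eInd L θ := by
  obtain ⟨c, -, h⟩ := exists_eInd_eq_smul_conjSum θ hHL
  have := Fintype.ofFinite L
  rw [h, conjSum, finsum_eq_sum_of_fintype, mul_smul_comm, smul_comm, Finset.mul_sum]
  congr 1
  rw [Finset.smul_sum]
  refine Finset.sum_congr rfl fun x _ => ?_
  have hx : Commute (single (x : G) (1 : ℚ)) z := hc x x.2
  rw [← mul_assoc, ← mul_assoc, ← hx.eq, mul_assoc (single (x : G) (1 : ℚ)), hr,
    mul_smul_comm, smul_mul_assoc]

theorem eInd_mul_self {L : Subgroup G} (hHL : H ≤ L) (hS : ShodaCond L (charHom θ)) :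
    eInd L θ * eInd L θ = eInd L θ := by
  have := central_mul_eInd θ hHL (fun g hg => commute_gel_eInd θ hHL hg) (r := 1)
    (by rw [eInd_mul_eInd_self θ hHL hS, one_smul])
  rwa [one_smul] at this

/-- The idempotent `e_ℚ(θ^L)` is primitive in the centre of `ℚL`. -/
theorem central_idempotent_mul_eInd {L : Subgroup G} (hHL : H ≤ L)
    (hS : ShodaCond L (charHom θ)) {z : MonoidAlgebra ℚ G} (hz : z ∈ subAlgOver ℚ L)
    (hc : ∀ g ∈ L, Commute (gel g) z) (hi : z * z = z) :
    z * eInd L θ = 0 ∨ z * eInd L θ = eInd L θ := by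
  have hc' : ∀ g ∈ L, Commute (single g (1 : linField θ)) (baseChange G (linField θ) z) := by
    intro g hg
    rw [← baseChange_gel]
    exact (hc g hg).map _
  rcases central_idempotent_mul_omega hHL (shodaCond_charFieldHom θ hS)
    (mapRingHom_mem _ hz) hc' (by rw [← map_mul, hi]) with h | h
  · left
    simpa using central_mul_eInd θ hHL hc (r := 0) (by simpa using mul_eInd_self_eq_zero θ h)
  · right
    simpa using central_mul_eInd θ hHL hc (r := 1) (by simpa using mul_eInd_self_eq θ h)

end RationalIdempotent

/-! ### The field of values of a linear character is cyclotomic -/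

section Cyclotomic

open MonoidAlgebra

variable {G : Type u} [Group G] [Finite G] {H : Subgroup G} (θ : H →* ℂˣ)

omit [Finite G] in
theorem kerChar_le : kerChar θ ≤ H := Subgroup.map_subtype_le _

omit [Finite G] in
theorem mem_kerChar {h : G} (hh : h ∈ H) : h ∈ kerChar θ ↔ θ ⟨h, hh⟩ = 1 := by
  constructor
  · rintro ⟨x, hx, rfl⟩
    exact hx
  · intro h1
    exact ⟨⟨h, hh⟩, h1, rfl⟩

omit [Finite G] in
theorem coe_mem_kerChar (h : H) : (h : G) ∈ kerChar θ ↔ charFieldHom θ h = 1 := by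
  rw [mem_kerChar θ h.2, ← Units.val_inj, ← Subtype.coe_inj, coe_charFieldHom]
  rfl

omit [Finite G] in
theorem relIndex_kerChar : (kerChar θ).relIndex H = Nat.card θ.range := by
  have : (kerChar θ).subgroupOf H = θ.ker :=
    Subgroup.comap_map_eq_self_of_injective H.subtype_injective _
  rw [Subgroup.relIndex, this, Subgroup.index_ker]

instance : Finite θ.range := Finite.of_surjective _ θ.rangeRestrict_surjective

instance : NeZero ((kerChar θ).relIndex H) := ⟨by
  rw [relIndex_kerChar]; exact Nat.card_pos.ne'⟩

/-- The values of `θ` are the powers of one primitive root of unity. -/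
theorem exists_generator : ∃ h₀ : H, IsPrimitiveRoot (charFieldHom θ h₀) ((kerChar θ).relIndex H) ∧
    ∀ h : H, ∃ j : ℕ, charFieldHom θ h = charFieldHom θ h₀ ^ j := by
  obtain ⟨⟨_, h₀, rfl⟩, hg⟩ := (isCyclic_of_injective_ringHom
    ((Units.coeHom ℂ).comp θ.range.subtype)
    (Units.val_injective.comp Subtype.val_injective)).exists_generator
  refine ⟨h₀, ?_, fun h => ?_⟩
  · rw [relIndex_kerChar, ← orderOf_eq_card_of_forall_mem_zpowers hg]
    have h1 := IsPrimitiveRoot.orderOf (⟨θ h₀, h₀, rfl⟩ : θ.range)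
    have h2 := h1.map_of_injective
      (f := (Units.coeHom ℂ).comp θ.range.subtype)
      (Units.val_injective.comp Subtype.val_injective)
    refine IsPrimitiveRoot.of_map_of_injective (f := (linField θ).val) ?_ Subtype.val_injective
    convert! h2
    exact coe_charFieldHom θ h₀
  · obtain ⟨j, hj⟩ := (mem_powers_iff_mem_zpowers.2 (hg ⟨θ h, h, rfl⟩))
    refine ⟨j, Subtype.ext ?_⟩
    have := congrArg (fun x : θ.range => ((x : ℂˣ) : ℂ)) hj
    rw [coe_charFieldHom]
    simpa [coe_charFieldHom] using this.symm

omit [Finite G] in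
theorem linField_eq_adjoin {h₀ : H} (hg : ∀ h : H, ∃ j : ℕ, charFieldHom θ h = charFieldHom θ h₀ ^ j) :
    linField θ = IntermediateField.adjoin ℚ {(charFieldHom θ h₀ : ℂ)} := by
  apply le_antisymm
  · rw [IntermediateField.adjoin_le_iff]
    rintro _ ⟨g, rfl⟩
    by_cases hgH : g ∈ H
    · obtain ⟨j, hj⟩ := hg ⟨g, hgH⟩
      have h1 := congrArg Subtype.val hj
      rw [coe_charFieldHom, ← extChar_of_mem θ hgH, SubmonoidClass.coe_pow] at h1
      rw [h1]
      exact pow_mem (IntermediateField.mem_adjoin_simple_self ℚ (charFieldHom θ h₀ : ℂ)) j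
    · rw [extChar_of_notMem _ hgH]
      exact zero_mem _
  · rw [IntermediateField.adjoin_simple_le_iff]
    exact (charFieldHom θ h₀).2

instance : IsCyclotomicExtension {(kerChar θ).relIndex H} ℚ (linField θ) := by
  obtain ⟨h₀, h1, h2⟩ := exists_generator θ
  have h3 : IsPrimitiveRoot (charFieldHom θ h₀ : ℂ) ((kerChar θ).relIndex H) :=
    h1.map_of_injective (f := (linField θ).val) Subtype.val_injective
  have := (IntermediateField.isCyclotomicExtension_singleton_iff_eq_adjoin _ ℚ ℂ (linField θ) h3).2
    (linField_eq_adjoin θ h2)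
  convert! this

/-- Powers of a linear character prime to its order are Galois conjugates. -/
theorem exists_galois_pow {j : ℕ} (hj : j.Coprime ((kerChar θ).relIndex H)) :
    ∃ σ : linField θ ≃ₐ[ℚ] linField θ,
      ((σ.toRingHom : linField θ →* linField θ)).comp (charFieldHom θ) = charFieldHom θ ^ j := by
  obtain ⟨h₀, h1, h2⟩ := exists_generator θ
  have hirr : Irreducible (Polynomial.cyclotomic ((kerChar θ).relIndex H) ℚ) :=
    Polynomial.cyclotomic.irreducible_rat (NeZero.pos _)
  -- Both `θ(h₀)` and `θ(h₀)^j` are primitive roots of unity of the same order, hence images of one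
  -- fixed `ζ` under automorphisms `σ₁` and `σ₂`. The automorphism wanted is `σ₂ ∘ σ₁⁻¹`.
  let σ₁ := IsCyclotomicExtension.fromZetaAut h1 hirr
  let σ₂ := IsCyclotomicExtension.fromZetaAut (h1.pow_of_coprime j hj) hirr
  have e1 : σ₁.symm (charFieldHom θ h₀) =
      IsCyclotomicExtension.zeta ((kerChar θ).relIndex H) ℚ (linField θ) := by
    rw [AlgEquiv.symm_apply_eq]
    exact (IsCyclotomicExtension.fromZetaAut_spec h1 hirr).symm
  refine ⟨σ₁.symm.trans σ₂, MonoidHom.ext fun h => ?_⟩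
  obtain ⟨i, hi⟩ := h2 h
  change σ₂ (σ₁.symm (charFieldHom θ h)) = charFieldHom θ h ^ j
  rw [hi, map_pow, map_pow, e1]
  have e2 : σ₂ (IsCyclotomicExtension.zeta ((kerChar θ).relIndex H) ℚ (linField θ)) =
      charFieldHom θ h₀ ^ j :=
    IsCyclotomicExtension.fromZetaAut_spec (h1.pow_of_coprime j hj) hirr
  rw [e2, ← pow_mul, ← pow_mul, mul_comm]

/-! ### The component of a linear character -/

/-- The complex scalars by which elements of `ℚH` act on `ω` form a `ℚ`-algebra containing the
values of `θ`. These values are algebraic, so the algebra they generate is already the field `ℚ(θ)`.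
-/
theorem exists_baseChange_mul_omega (t : linField θ) :
    ∃ a ∈ subAlg H, baseChange G (linField θ) a * omega (charFieldHom θ) =
      t • omega (charFieldHom θ) := by
  obtain ⟨t, ht⟩ := t
  let S : Subalgebra ℚ ℂ :=
    { carrier := {t | ∃ a ∈ subAlg H, baseChange G ℂ a * omega (charHom θ) =
        t • omega (charHom θ)}
      mul_mem' := by
        rintro s t ⟨a, ha, h⟩ ⟨b, hb, h'⟩
        refine ⟨a * b, mul_mem ha hb, ?_⟩
        rw [map_mul, mul_assoc, h', mul_smul_comm, h, smul_smul, mul_comm]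
      add_mem' := by
        rintro s t ⟨a, ha, h⟩ ⟨b, hb, h'⟩
        refine ⟨a + b, add_mem ha hb, ?_⟩
        rw [map_add, add_mul, h, h', add_smul]
      algebraMap_mem' := fun r => ⟨algebraMap ℚ _ r, algebraMap_mem _ r, by
        have : baseChange G ℂ (algebraMap ℚ (MonoidAlgebra ℚ G) r) = single 1 (r : ℂ) := by
          simp [mapRingHom_single]
        rw [this]
        ext y
        simp⟩ }
  have hS : (linField θ).toSubalgebra ≤ S := by
    rw [IntermediateField.adjoin_toSubalgebra_of_isAlgebraic, Algebra.adjoin_le_iff]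
    · rintro _ ⟨g, rfl⟩
      by_cases hg : g ∈ H
      · refine ⟨gel g, gel_mem_subAlg hg, ?_⟩
        rw [baseChange_gel, extChar_of_mem θ hg]
        exact single_mul_omega (charHom θ) ⟨g, hg⟩
      · rw [extChar_of_notMem θ hg]
        exact zero_mem S
    · rintro _ ⟨g, rfl⟩
      exact (isIntegral_extChar θ g).isAlgebraic
  obtain ⟨a, ha, h⟩ := hS ht
  refine ⟨a, ha, ?_⟩
  apply mapRingHom_injective (fieldIncl (extChar θ) : linField θ →+* ℂ)
  have e : ∀ x : MonoidAlgebra (linField θ) G, mapRingHom G (fieldIncl (extChar θ) :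
      linField θ →+* ℂ) ((⟨t, ht⟩ : linField θ) • x) =
        t • mapRingHom G (fieldIncl (extChar θ) : linField θ →+* ℂ) x := by
    intro x
    ext y
    simp only [mapRingHom, RingHom.coe_mk, MonoidHom.coe_mk, OneHom.coe_mk, coeff_map,
      Finsupp.mapRange_apply, coeff_smul_apply, smul_eq_mul]
    exact map_mul (fieldIncl (extChar θ)) _ _
  rw [map_mul, e, mapRingHom_baseChange, mapRingHom_omega, fieldIncl_comp_charFieldHom, h]

theorem mem_component {L : Subgroup G} (hHL : H ≤ L) (hS : ShodaCond L (charHom θ))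
    {a : MonoidAlgebra ℚ G} : a ∈ component L θ ↔ a ∈ subAlg L ∧ a * eInd L θ = a := by
  constructor
  · rintro ⟨b, hb, rfl⟩
    exact ⟨mul_mem hb (eQ_mem_subAlg _ _), by rw [mul_assoc, eInd_mul_self θ hHL hS]⟩
  · rintro ⟨h1, h2⟩
    exact ⟨a, h1, h2.symm⟩

/-- `t ↦ Tr(t ω)`. -/
def traceOmega : linField θ →+ MonoidAlgebra ℚ G where
  toFun t := MonoidAlgebra.map (Algebra.trace ℚ (linField θ)).toAddMonoidHom
    (t • omega (charFieldHom θ))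
  map_zero' := by simp
  map_add' s t := by rw [add_smul, MonoidAlgebra.map_add]

theorem traceOmega_one : traceOmega θ 1 = eInd H θ := by
  rw [eInd_self_eq]
  change MonoidAlgebra.map _ ((1 : linField θ) • _) = _
  rw [one_smul]

theorem traceOmega_eq {a : MonoidAlgebra ℚ G} {t : linField θ}
    (h : baseChange G (linField θ) a * omega (charFieldHom θ) = t • omega (charFieldHom θ)) :
    traceOmega θ t = a * eInd H θ := by
  rw [eInd_self_eq, ← map_baseChange_mul, h]
  rfl

/-- The trace is not multiplicative, but scalars realized by `a` and `b` in `ℚH` have images `a e`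
and `b e`, where `e = e_ℚ(θ)` is an idempotent commuting with `ℚH`. -/
theorem traceOmega_mul (s t : linField θ) :
    traceOmega θ (s * t) = traceOmega θ s * traceOmega θ t := by
  obtain ⟨a, ha, h⟩ := exists_baseChange_mul_omega θ s
  obtain ⟨b, hb, h'⟩ := exists_baseChange_mul_omega θ t
  have h1 : baseChange G (linField θ) (a * b) * omega (charFieldHom θ) =
      (s * t) • omega (charFieldHom θ) := by
    rw [map_mul, mul_assoc, h', mul_smul_comm, h, smul_smul, mul_comm]
  have hc : Commute b (eInd H θ) := commute_of_mem_subAlgOver hb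
    fun g hg => commute_gel_eInd θ le_rfl hg
  rw [traceOmega_eq θ h, traceOmega_eq θ h', traceOmega_eq θ h1, mul_assoc a (eInd H θ),
    ← mul_assoc _ b, ← hc.eq, mul_assoc b, eInd_mul_self θ le_rfl (shodaCond_self _), mul_assoc]

theorem traceOmega_injective : Function.Injective (traceOmega θ) := by
  rw [injective_iff_map_eq_zero]
  intro t ht
  by_contra h0
  apply eInd_self_ne_zero θ
  rw [← traceOmega_one, ← mul_inv_cancel₀ h0, traceOmega_mul, ht, zero_mul]

/-- The component `ℚH e_ℚ(θ)` of a linear character is isomorphic to `ℚ(θ)`. -/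
def linFieldEquivComponent : linField θ ≃+* component H θ := by
  have hmem : ∀ t, traceOmega θ t ∈ component H θ := fun t => by
    obtain ⟨a, ha, h⟩ := exists_baseChange_mul_omega θ t
    exact ⟨a, ha, traceOmega_eq θ h⟩
  refine RingEquiv.ofBijective (R := linField θ) (S := component H θ)
    ({ toFun := fun t => ⟨traceOmega θ t, hmem t⟩
       map_zero' := Subtype.ext (map_zero _)
       map_add' := fun s t => Subtype.ext (map_add _ s t)
       map_mul' := fun s t => Subtype.ext (traceOmega_mul θ s t) } :
      linField θ →ₙ+* component H θ) ⟨fun s t h => ?_, ?_⟩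
  · exact traceOmega_injective θ (congrArg Subtype.val h)
  · rintro ⟨_, a, ha, rfl⟩
    obtain ⟨r, hr, -⟩ := exists_mul_omega (charFieldHom θ)
      (mapRingHom_mem (algebraMap ℚ (linField θ)) ha)
    exact ⟨r, Subtype.ext (traceOmega_eq θ hr)⟩

theorem nonempty_component_equiv_cyclotomic :
    Nonempty (component H θ ≃+* CyclotomicField ((kerChar θ).relIndex H) ℚ) :=
  have : IsCyclotomicExtension {(kerChar θ).relIndex H} ℚ
      (CyclotomicField ((kerChar θ).relIndex H) ℚ) := by
    convert! CyclotomicField.isCyclotomicExtension ((kerChar θ).relIndex H) ℚ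
  ⟨(linFieldEquivComponent θ).symm.trans
    (IsCyclotomicExtension.algEquiv {(kerChar θ).relIndex H} ℚ (linField θ)
      (CyclotomicField ((kerChar θ).relIndex H) ℚ)).toRingEquiv⟩

end Cyclotomic

/-! ### The idempotents `ε(H, K)` -/

section Hat

open MonoidAlgebra

variable {G : Type u} [Group G] [Finite G]

theorem omega_one_eq {k : Type v} [Field k] [Algebra ℚ k] (B : Subgroup G) :
    omega (1 : B →* k) = baseChange G k (hat B) := by
  have := Fintype.ofFinite B
  rw [omega, hat, finsum_eq_sum_of_fintype, finsum_eq_sum_of_fintype]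
  ext y
  simp only [mapRingHom, RingHom.coe_mk, MonoidHom.coe_mk, OneHom.coe_mk, coeff_map,
    Finsupp.mapRange_apply, coeff_smul_apply, smul_eq_mul, MonoidHom.one_apply, coeff_sum,
    Finsupp.finsetSum_apply]
  change _ = algebraMap ℚ k _
  rw [map_mul, map_inv₀, map_natCast, map_sum]
  congr 1
  refine Fintype.sum_equiv (Equiv.inv B) _ _ fun x => ?_
  classical
  simp [gel, Finsupp.single_apply]

theorem coeff_hat (B : Subgroup G) (y : G) [Decidable (y ∈ B)] :
    (hat B).coeff y = if y ∈ B then (Nat.card B : ℚ)⁻¹ else 0 := by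
  have h := omega_one_eq (k := ℚ) B
  have h2 : baseChange G ℚ (hat B) = hat B := by
    ext y
    simp [mapRingHom]
  rw [h2] at h
  rw [← h, coeff_omega]
  split_ifs with hy
  · rw [extHom_of_mem _ (B.inv_mem hy)]; simp
  · rw [extHom_of_notMem _ (by simpa using hy), mul_zero]

theorem hat_mem {B L : Subgroup G} (h : B ≤ L) : hat B ∈ subAlgOver ℚ L := by
  have := Fintype.ofFinite B
  rw [hat, finsum_eq_sum_of_fintype]
  exact Subalgebra.smul_mem _ (sum_mem fun x _ => single_mem_subAlgOver (h x.2) _) _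

theorem hat_mul_of_forall {B : Subgroup G} {a : MonoidAlgebra ℚ G}
    (h : ∀ b ∈ B, gel b * a = a) : hat B * a = a := by
  have := Fintype.ofFinite B
  rw [hat, finsum_eq_sum_of_fintype, smul_mul_assoc, Finset.sum_mul,
    Finset.sum_congr rfl fun b _ => h b.1 b.2, Finset.sum_const, Finset.card_univ,
    ← Nat.card_eq_fintype_card, ← Nat.cast_smul_eq_nsmul ℚ, smul_smul,
    inv_mul_cancel₀ (natCard_ne_zero ℚ B), one_smul]

theorem hat_mul_hat_of_le {K L : Subgroup G} (h : K ≤ L) : hat K * hat L = hat L :=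
  hat_mul_of_forall fun _ hb => gel_mul_hat (h hb)

theorem hat_mul_hat_of_le' {K L : Subgroup G} (h : K ≤ L) : hat L * hat K = hat L := by
  rw [← (hat_commute_of_le h).eq, hat_mul_hat_of_le h]

theorem baseChange_hat_mul_omega {H B : Subgroup G} (hB : B ≤ H) {k : Type v} [Field k]
    [CharZero k] [Algebra ℚ k] {ϑ : H →* k} (h : ∀ b : H, (b : G) ∈ B → ϑ b = 1) :
    baseChange G k (hat B) * omega ϑ = omega ϑ := by
  rw [← omega_one_eq]
  refine omega_mul_of_forall _ fun b => ?_
  have := single_mul_omega ϑ ⟨b, hB b.2⟩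
  rw [h _ b.2] at this
  exact this

/-- Inserting `b` between `B̂` and `ω` changes nothing on the left and multiplies by `ϑ b ≠ 1` on
the right. -/
theorem baseChange_hat_mul_omega_eq_zero {H B : Subgroup G} {k : Type v} [Field k]
    [CharZero k] [Algebra ℚ k] {ϑ : H →* k} {b : H} (hb : (b : G) ∈ B) (h : ϑ b ≠ 1) :
    baseChange G k (hat B) * omega ϑ = 0 := by
  have h1 : baseChange G k (hat B) * omega ϑ = ϑ b • (baseChange G k (hat B) * omega ϑ) := by
    rw [← mul_smul_comm, ← single_mul_omega, ← mul_assoc, ← baseChange_gel, ← map_mul,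
      hat_mul_gel hb]
  have h2 : (ϑ b - 1) • (baseChange G k (hat B) * omega ϑ) = 0 := by
    rw [sub_smul, ← h1, one_smul, sub_self]
  exact (smul_eq_zero.1 h2).resolve_left (sub_ne_zero.2 h)

omit [Finite G] in
theorem gel_mul_gel_inv (g : G) : gel g * gel g⁻¹ = 1 := single_mul_single_inv g

omit [Finite G] in
theorem gel_inv_mul_gel (g : G) : gel g⁻¹ * gel g = 1 := single_inv_mul_single g

omit [Finite G] in
theorem conj_mul_conj (g : G) (a b : MonoidAlgebra ℚ G) :
    gel g * a * gel g⁻¹ * (gel g * b * gel g⁻¹) = gel g * (a * b) * gel g⁻¹ := by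
  simp only [mul_assoc]
  rw [← mul_assoc (gel g⁻¹), gel_inv_mul_gel, one_mul]

omit [Finite G] in
theorem conj_conj_inv (g : G) (a : MonoidAlgebra ℚ G) :
    gel g * (gel g⁻¹ * a * gel g) * gel g⁻¹ = a := by
  simp only [mul_assoc, gel_mul_gel_inv, mul_one]
  rw [← mul_assoc, gel_mul_gel_inv, one_mul]

omit [Finite G] in
theorem gel_commute_iff {g : G} {a : MonoidAlgebra ℚ G} :
    Commute (gel g) a ↔ gel g * a * gel g⁻¹ = a := by
  constructor
  · intro h
    rw [h.eq, mul_assoc, gel_mul_gel_inv, mul_one]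
  · intro h
    have : gel g * a = gel g * a * gel g⁻¹ * gel g := by
      rw [mul_assoc, gel_inv_mul_gel, mul_one]
    rw [Commute, SemiconjBy, this, h]

theorem exists_conj_hat {M : Subgroup G} (g : G) : ∃ M' : Subgroup G,
    (∀ x, x ∈ M' ↔ g * x * g⁻¹ ∈ M) ∧ gel g⁻¹ * hat M * gel g = hat M' := by
  classical
  refine ⟨M.comap (MulAut.conj g).toMonoidHom, fun x => by simp, ?_⟩
  have hc : Nat.card (M.comap (MulAut.conj g).toMonoidHom) = Nat.card M :=
    Nat.card_congr ((MulAut.conj g).toEquiv.subtypeEquiv fun _ => Iff.rfl)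
  ext y
  rw [coeff_hat]
  simp only [gel, of_apply]
  rw [coeff_mul_single_apply, coeff_single_mul_apply, coeff_hat, hc]
  simp [mul_assoc]

end Hat

/-! ### The identity `ε(H, ker θ) = e_ℚ(θ)` and the normalizer of the kernel -/

section Eps

open MonoidAlgebra

variable {G : Type u} [Group G] [Finite G] {H : Subgroup G} (θ : H →* ℂˣ)

/-- Since `e_ℚ(θ)` fixes `ω`, on which `h` acts as `θ(h)`, the idempotent determines the kernel of
`θ`. Commutation with `e_ℚ(θ)` can therefore be turned into statements about that kernel. -/
theorem gel_mul_eInd_self_iff {h : G} (hh : h ∈ H) :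
    gel h * eInd H θ = eInd H θ ↔ h ∈ kerChar θ := by
  have h1 : baseChange G (linField θ) (gel h) * omega (charFieldHom θ) =
      charFieldHom θ ⟨h, hh⟩ • omega (charFieldHom θ) := by
    rw [baseChange_gel]; exact single_mul_omega (charFieldHom θ) ⟨h, hh⟩
  have h2 := baseChange_eInd_mul_omega_field θ le_rfl (shodaCond_self _)
  rw [show h ∈ kerChar θ ↔ _ from coe_mem_kerChar θ ⟨h, hh⟩]
  constructor
  · intro h3
    have h4 : charFieldHom θ ⟨h, hh⟩ • omega (charFieldHom θ) = omega (charFieldHom θ) := by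
      rw [← h1]
      conv_lhs => rw [← h2]
      rw [← mul_assoc, ← map_mul, h3, h2]
    have h5 : (charFieldHom θ ⟨h, hh⟩ - 1) • omega (charFieldHom θ) = 0 := by
      rw [sub_smul, h4, one_smul, sub_self]
    exact sub_eq_zero.1 ((smul_eq_zero.1 h5).resolve_right (omega_ne_zero _))
  · intro h3
    rw [h3, one_smul] at h1
    exact mul_eInd_self_eq θ h1

theorem hat_kerChar_mul_eInd : hat (kerChar θ) * eInd H θ = eInd H θ :=
  hat_mul_of_forall fun _ hb => (gel_mul_eInd_self_iff θ (kerChar_le θ hb)).2 hb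

theorem hat_mul_eInd_eq_zero {M : Subgroup G} (hM : M ≤ H) (h : ¬ M ≤ kerChar θ) :
    hat M * eInd H θ = 0 := by
  obtain ⟨m, hm, hmk⟩ := SetLike.not_le_iff_exists.1 h
  refine mul_eInd_self_eq_zero θ (baseChange_hat_mul_omega_eq_zero (b := ⟨m, hM hm⟩) hm ?_)
  rwa [ne_eq, ← coe_mem_kerChar]

/-- The idempotent of the kernel is the sum of the idempotents of the powers of `θ`. -/
theorem baseChange_hat_kerChar : baseChange G (linField θ) (hat (kerChar θ)) =
    ∑ j ∈ Finset.range ((kerChar θ).relIndex H), omega (charFieldHom θ ^ j) := by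
  classical
  have hk : ((kerChar θ).relIndex H : linField θ) * Nat.card (kerChar θ) = Nat.card H := by
    rw [← Nat.cast_mul, mul_comm, ← Subgroup.relIndex_bot_left, ← Subgroup.relIndex_bot_left,
      Subgroup.relIndex_mul_relIndex _ _ _ bot_le (kerChar_le θ)]
  have hk0 := natCard_ne_zero (linField θ) (kerChar θ)
  have hH0 := natCard_ne_zero (linField θ) H
  refine MonoidAlgebra.ext (Finsupp.ext fun y => ?_)
  rw [coeff_sum, Finsupp.finsetSum_apply]
  simp only [coeff_omega]
  rw [← Finset.mul_sum]
  change algebraMap ℚ (linField θ) ((hat (kerChar θ)).coeff y) = _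
  rw [coeff_hat]
  by_cases hy : y⁻¹ ∈ H
  · have h1 := coe_mem_kerChar θ ⟨y⁻¹, hy⟩
    simp only [inv_mem_iff] at h1
    simp only [extHom_of_mem _ hy, MonoidHom.pow_apply]
    split_ifs with hyk
    · rw [h1.1 hyk]
      simp only [one_pow, Finset.sum_const, Finset.card_range, nsmul_eq_mul, mul_one, map_inv₀,
        map_natCast]
      rw [← hk]
      have hr : ((kerChar θ).relIndex H : linField θ) ≠ 0 := by
        intro h; rw [h, zero_mul] at hk; exact hH0 hk.symm
      field_simp
    · have h2 : charFieldHom θ ⟨y⁻¹, hy⟩ ≠ 1 := fun h => hyk (h1.2 h)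
      -- Off the kernel, the value of `θ` is a `k`-th root of unity different from `1`, so its
      -- powers sum to zero.
      have h3 := mul_neg_geom_sum (charFieldHom θ ⟨y⁻¹, hy⟩) ((kerChar θ).relIndex H)
      obtain ⟨h₀, hp, hg⟩ := exists_generator θ
      obtain ⟨j, hj⟩ := hg ⟨y⁻¹, hy⟩
      have h4 : charFieldHom θ ⟨y⁻¹, hy⟩ ^ (kerChar θ).relIndex H = 1 := by
        rw [hj, ← pow_mul, mul_comm, pow_mul, hp.pow_eq_one, one_pow]
      rw [h4, sub_self] at h3
      rw [(mul_eq_zero.1 h3).resolve_left (sub_ne_zero.2 h2.symm), mul_zero, map_zero]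
  · have hyk : y ∉ kerChar θ := fun h => hy (H.inv_mem (kerChar_le θ h))
    simp [extHom_of_notMem _ hy, hyk]

/-- An element of `ℚG K̂`, `K = ker θ`, which is annihilated by `e_ℚ(θ)` and by `M̂` for the normal
subgroups `M > K` of `H` vanishes. -/
theorem eq_zero_of_mul_eInd_eq_zero {a : MonoidAlgebra ℚ G} (h1 : a * hat (kerChar θ) = a)
    (h2 : ∀ M, IsNormalAbove H (kerChar θ) M → a * hat M = 0) (h3 : a * eInd H θ = 0) :
    a = 0 := by
  obtain ⟨h₀, hp, hg⟩ := exists_generator θ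
  have hω : baseChange G (linField θ) a * omega (charFieldHom θ) = 0 := by
    rw [← baseChange_eInd_mul_omega_field θ le_rfl (shodaCond_self _), ← mul_assoc, ← map_mul, h3,
      map_zero, zero_mul]
  apply mapRingHom_injective (algebraMap ℚ (linField θ))
  rw [map_zero, ← h1, map_mul, baseChange_hat_kerChar, Finset.mul_sum]
  refine Finset.sum_eq_zero fun j _ => ?_
  by_cases hj : j.Coprime ((kerChar θ).relIndex H)
  -- Here `θ^j` is a Galois conjugate of `θ`, and `a`, being rational, annihilates its idempotent
  -- along with `ω`.
  · obtain ⟨σ, hσ⟩ := exists_galois_pow θ hj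
    have := congrArg (mapRingHom G σ.toRingHom) hω
    rw [map_mul, mapRingHom_omega, map_zero] at this
    rw [← hσ]
    convert! this using 2
    exact (mapRingHom_baseChange (σ : linField θ →ₐ[ℚ] linField θ) a).symm
  -- Otherwise `θ^j` has a kernel `M` larger than `K`. Then `M̂` fixes the idempotent of `θ^j` while
  -- `a` annihilates `M̂`.
  · set M : Subgroup G := (charFieldHom θ ^ j).ker.map H.subtype
    have hmem : ∀ h : H, (h : G) ∈ M ↔ charFieldHom θ h ^ j = 1 := by
      intro h
      simp [M, MonoidHom.mem_ker]
    have hMH : M ≤ H := Subgroup.map_subtype_le _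
    have hM : IsNormalAbove H (kerChar θ) M := by
      refine ⟨hMH, ?_, lt_of_le_of_ne ?_ ?_⟩
      · have : M.subgroupOf H = (charFieldHom θ ^ j).ker :=
          Subgroup.comap_map_eq_self_of_injective H.subtype_injective _
        rw [this]
        infer_instance
      · intro x hx
        have := (coe_mem_kerChar θ ⟨x, kerChar_le θ hx⟩).1 hx
        exact (hmem ⟨x, kerChar_le θ hx⟩).2 (by rw [this, one_pow])
      · intro hKM
        apply hj
        set k := (kerChar θ).relIndex H with hk
        -- The witness for `M ≠ K`: this power of the generator lies in the kernel of `θ^j`, and it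
        -- would lie in `K` only if `k` divided `k / gcd(j, k)`, that is, if `j` were prime to `k`.
        have hd : charFieldHom θ (h₀ ^ (k / j.gcd k)) ^ j = 1 := by
          rw [map_pow, ← pow_mul]
          obtain ⟨c, hc⟩ := Nat.gcd_dvd_left j k
          have e : k / j.gcd k * j = k * c := by
            calc k / j.gcd k * j = k / j.gcd k * (j.gcd k * c) := by rw [← hc]
              _ = k * c := by rw [← mul_assoc, Nat.div_mul_cancel (Nat.gcd_dvd_right j k)]
          rw [e, pow_mul, hp.pow_eq_one, one_pow]
        rw [← hmem, ← hKM, coe_mem_kerChar, map_pow, hp.pow_eq_one_iff_dvd] at hd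
        have hpos : 0 < j.gcd k := Nat.gcd_pos_of_pos_right _ (NeZero.pos k)
        have h4 : k ≤ k / j.gcd k := Nat.le_of_dvd
          (Nat.div_pos (Nat.le_of_dvd (NeZero.pos k) (Nat.gcd_dvd_right j k)) hpos) hd
        by_contra hne
        have : 1 < j.gcd k := lt_of_le_of_ne hpos (Ne.symm hne)
        exact absurd (Nat.div_lt_self (NeZero.pos k) this) (not_lt.2 h4)
    rw [← baseChange_hat_mul_omega hMH (fun b hb => (hmem b).1 hb), ← mul_assoc, ← map_mul,
      h2 M hM, map_zero, zero_mul]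

/-- `ε(H, ker θ) = e_ℚ(θ)`. -/
theorem eps_kerChar : eps H (kerChar θ) = eInd H θ := by
  classical
  set K := kerChar θ with hK
  set s := (Set.toFinite {L : Subgroup G | Minimal (IsNormalAbove H K) L}).toFinset with hs
  have hmin : ∀ M ∈ s, Minimal (IsNormalAbove H K) M := fun M hM => by simpa [hs] using hM
  have hfix : eps H K * eInd H θ = eInd H θ := by
    rw [eps]
    split_ifs with hHK
    · exact hat_kerChar_mul_eInd θ
    · refine Finset.noncommProd_induction _ _ _ (fun a => a * eInd H θ = eInd H θ)
        (fun a b ha hb => by rw [mul_assoc, hb, ha]) (one_mul _) fun M hM => ?_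
      obtain ⟨⟨h1, -, h2⟩, -⟩ := hmin M hM
      rw [sub_mul, hat_kerChar_mul_eInd, hat_mul_eInd_eq_zero θ h1 (not_le_of_gt h2), sub_zero]
  have hfactor : ∀ M ∈ s, H ≠ K → ∃ b, eps H K = b * (hat K - hat M) := by
    intro M hM hHK
    rw [eps, if_neg hHK]
    exact ⟨_, (Finset.noncommProd_erase_mul s hM _ _).symm⟩
  have hex : ∀ M, IsNormalAbove H K M → ∃ M' ∈ s, M' ≤ M := by
    intro M hM
    obtain ⟨M', hle, hM'⟩ := (Set.toFinite {L | IsNormalAbove H K L}).exists_le_minimal hM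
    exact ⟨M', by simpa [hs] using hM', hle⟩
  have hK1 : eps H K * hat K = eps H K := by
    by_cases hHK : H = K
    · rw [eps, if_pos hHK, hat_mul_hat_of_le le_rfl]
    -- The subgroup `H` itself lies properly above `K`, so the product defining `ε` is not empty;
    -- any single factor absorbs `K̂`.
    · have hH : IsNormalAbove H K H := ⟨le_rfl, by
        rw [Subgroup.subgroupOf_self]; infer_instance, lt_of_le_of_ne (kerChar_le θ) (Ne.symm hHK)⟩
      obtain ⟨M, hM, -⟩ := hex H hH
      obtain ⟨b, hb⟩ := hfactor M hM hHK
      rw [hb, mul_assoc, sub_mul, hat_mul_hat_of_le le_rfl,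
        hat_mul_hat_of_le' (hmin M hM).1.2.2.le]
  have hK2 : ∀ M, IsNormalAbove H K M → eps H K * hat M = 0 := by
    intro M hM
    have hHK : H ≠ K := fun h => not_le_of_gt hM.2.2 (h ▸ hM.1)
    -- Below `M` there is a minimal `M'`, and its factor satisfies `(K̂ - M̂') M̂ = M̂ - M̂ = 0`.
    obtain ⟨M', hM', hle⟩ := hex M hM
    obtain ⟨b, hb⟩ := hfactor M' hM' hHK
    rw [hb, mul_assoc, sub_mul, hat_mul_hat_of_le hM.2.2.le, hat_mul_hat_of_le hle, sub_self,
      mul_zero]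
  have hcomm : ∀ M ≤ H, Commute (hat M) (eInd H θ) := fun M hM =>
    commute_of_mem_subAlgOver (hat_mem hM) fun g hg => commute_gel_eInd θ le_rfl hg
  -- Both elements absorb `K̂`, are annihilated by every `M̂` above `K`, and give `e_ℚ(θ)` when
  -- multiplied by it. The vanishing criterion applies to their difference.
  have key : eps H K - eInd H θ = 0 := by
    apply eq_zero_of_mul_eInd_eq_zero θ
    · rw [sub_mul, hK1, ← (hcomm K (kerChar_le θ)).eq, hat_kerChar_mul_eInd]
    · intro M hM
      rw [sub_mul, hK2 M hM, ← (hcomm M hM.1).eq,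
        hat_mul_eInd_eq_zero θ hM.1 (not_le_of_gt hM.2.2), sub_zero]
    · rw [sub_mul, hfix, eInd_mul_self θ le_rfl (shodaCond_self _), sub_self]
  exact sub_eq_zero.1 key

/-- `e(L, H, ker θ)` is a multiple of `e_ℚ(θ^L)`. -/
theorem exists_eSum_eq_smul_eInd {L : Subgroup G} (hHL : H ≤ L) :
    ∃ c : ℚ, c ≠ 0 ∧ eSum L H (kerChar θ) = c • eInd L θ := by
  classical
  have := Fintype.ofFinite L
  set ε := eInd H θ with hε
  let f : L → MonoidAlgebra ℚ G := fun x => gel (x : G) * ε * gel (x : G)⁻¹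
  have hset : {a | ∃ x ∈ L, a = gel x⁻¹ * eps H (kerChar θ) * gel x} =
      ((Finset.univ.image f : Finset _) : Set (MonoidAlgebra ℚ G)) := by
    rw [eps_kerChar]
    ext a
    simp only [Set.mem_ofPred_eq, Finset.coe_image, Finset.coe_univ, Set.image_univ, Set.mem_range]
    constructor
    · rintro ⟨x, hx, rfl⟩
      exact ⟨⟨x, hx⟩⁻¹, by simp [f, hε]⟩
    · rintro ⟨x, rfl⟩
      exact ⟨(x : G)⁻¹, L.inv_mem x.2, by simp [f, hε]⟩
  -- Left translation by `y` carries the stabilizer of `ε` onto the fibre over `f y`. All fibres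
  -- having the same size `m`, the sum over `L` is `m` times the sum over the distinct conjugates.
  have hcard : ∀ b ∈ Finset.univ.image f, (Finset.univ.filter fun x => f x = b).card =
      (Finset.univ.filter fun x => f x = ε).card := by
    intro b hb
    obtain ⟨y, -, rfl⟩ := Finset.mem_image.1 hb
    have hf : ∀ x, f (y * x) = gel (y : G) * f x * gel (y : G)⁻¹ := by
      intro x
      simp only [f, Subgroup.coe_mul, mul_inv_rev, gel, map_mul, mul_assoc]
    refine (Finset.card_bij (fun x _ => y * x) ?_ (fun a _ b _ h => mul_left_cancel h) ?_).symm
    · intro x hx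
      rw [Finset.mem_filter] at hx ⊢
      exact ⟨Finset.mem_univ _, by rw [hf, hx.2]⟩
    · intro x hx
      rw [Finset.mem_filter] at hx
      refine ⟨y⁻¹ * x, ?_, by simp⟩
      rw [Finset.mem_filter]
      refine ⟨Finset.mem_univ _, ?_⟩
      have h1 := hf (y⁻¹ * x)
      rw [mul_inv_cancel_left, hx.2] at h1
      have h2 : gel (y : G)⁻¹ * f y * gel (y : G) =
          gel (y : G)⁻¹ * (gel (y : G) * f (y⁻¹ * x) * gel (y : G)⁻¹) * gel (y : G) := by rw [← h1]
      simp only [f, mul_assoc, gel_inv_mul_gel, mul_one] at h2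
      simp only [← mul_assoc, gel_inv_mul_gel, one_mul] at h2
      simp only [f]
      exact h2.symm
  set m := (Finset.univ.filter fun x => f x = ε).card with hm
  have hm0 : m ≠ 0 := by
    refine Finset.card_ne_zero.2 ⟨1, ?_⟩
    simp [f, ← one_def]
  have hsum : conjSum L ε = (m : ℚ) • eSum L H (kerChar θ) := by
    rw [eSum, hset, finsum_mem_coe_finset, conjSum, finsum_eq_sum_of_fintype]
    change ∑ x : L, f x = _
    rw [Finset.sum_comp (fun a => a) f, Finset.sum_congr rfl fun b hb => by rw [hcard b hb],
      ← Finset.smul_sum, Nat.cast_smul_eq_nsmul]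
  obtain ⟨c, hc, h⟩ := exists_eInd_eq_smul_conjSum θ hHL
  have hm' : (m : ℚ) ≠ 0 := Nat.cast_ne_zero.2 hm0
  refine ⟨(c * m)⁻¹, inv_ne_zero (mul_ne_zero hc hm'), ?_⟩
  rw [h, ← hε, hsum, smul_smul c, smul_smul, inv_mul_cancel₀ (mul_ne_zero hc hm'), one_smul]

omit [Finite G] in
theorem cen_smul (M : Subgroup G) (a : MonoidAlgebra ℚ G) {c : ℚ} (hc : c ≠ 0) :
    cen M (c • a) = cen M a := by
  ext g
  refine and_congr_right fun _ => ⟨fun h => ?_, fun h => h.smul_right c⟩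
  simpa [smul_smul, inv_mul_cancel₀ hc] using h.smul_right c⁻¹

/-- The two elements differ by a nonzero rational factor. This reconciles the two descriptions of
`C_i`. -/
theorem cen_eSum {L : Subgroup G} (hHL : H ≤ L) (M : Subgroup G) :
    cen M (eSum L H (kerChar θ)) = cen M (eInd L θ) := by
  obtain ⟨c, hc, h⟩ := exists_eSum_eq_smul_eInd θ hHL
  rw [h, cen_smul M _ hc]

/-- An element which centralizes `e_ℚ(θ)` and normalizes `H` normalizes the kernel of `θ`. -/
theorem conj_mem_kerChar {g : G} (hgH : ∀ h ∈ H, g * h * g⁻¹ ∈ H)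
    (hc : Commute (gel g) (eInd H θ)) {x : G} (hx : x ∈ kerChar θ) :
    g * x * g⁻¹ ∈ kerChar θ := by
  have hxH := kerChar_le θ hx
  rw [← gel_mul_eInd_self_iff θ (hgH x hxH)]
  rw [← gel_mul_eInd_self_iff θ hxH] at hx
  have hc' := gel_commute_iff.1 hc
  have h1 : gel (g * x * g⁻¹) * eInd H θ =
      gel g * gel x * (gel g⁻¹ * eInd H θ * gel g) * gel g⁻¹ := by
    simp only [gel, map_mul, mul_assoc]
    rw [← map_mul (of ℚ G) g g⁻¹]
    simp [← one_def]
  have h2 : gel g⁻¹ * eInd H θ * gel g = eInd H θ := by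
    rw [mul_assoc, ← hc.eq, ← mul_assoc, gel_inv_mul_gel, one_mul]
  rw [h1, h2, mul_assoc (gel g), hx, hc']

/-- If `g` normalizes `L`, then `e_ℚ(θ^L)` is orthogonal to its conjugate, or centralized by `g`. -/
theorem conj_eInd_mul_eq_zero_or {L : Subgroup G} (hHL : H ≤ L) (hS : ShodaCond L (charHom θ))
    {g : G} (hg : ∀ h, h ∈ L ↔ g * h * g⁻¹ ∈ L) :
    gel g * eInd L θ * gel g⁻¹ * eInd L θ = 0 ∨ Commute (gel g) (eInd L θ) := by
  set e := eInd L θ with he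
  have hidem : e * e = e := eInd_mul_self θ hHL hS
  have hcen : ∀ a ∈ subAlgOver ℚ L, Commute a e := fun a ha =>
    commute_of_mem_subAlgOver ha fun g hg => commute_gel_eInd θ hHL hg
  -- The conjugate is again a central idempotent of `ℚL`, so the primitivity of `e` applies to it.
  have hconj : ∀ g : G, (∀ h, h ∈ L ↔ g * h * g⁻¹ ∈ L) →
      gel g * e * gel g⁻¹ * e = 0 ∨ gel g * e * gel g⁻¹ * e = e := by
    intro g hg
    refine central_idempotent_mul_eInd θ hHL hS
      (conj_mem_subAlgOver (fun x hx => (hg x).1 hx) (eInd_mem θ L)) (fun h hh => ?_) ?_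
    · have h1 : g⁻¹ * h * g ∈ L := by rw [hg]; simpa [mul_assoc] using hh
      have h2 : gel g⁻¹ * gel h * gel g ∈ subAlgOver ℚ L := by
        simpa [gel, single_mul_single] using single_mem_subAlgOver h1 (1 : ℚ)
      rw [← conj_conj_inv g (gel h), Commute, SemiconjBy, conj_mul_conj, conj_mul_conj,
        (hcen _ h2).eq]
    · exact (conj_mul_conj g e e).trans (by rw [hidem])
  rcases hconj g hg with h1 | h1
  · exact Or.inl h1
  have hg' : ∀ h, h ∈ L ↔ g⁻¹ * h * g⁻¹⁻¹ ∈ L := fun h => by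
    rw [hg (g⁻¹ * h * g⁻¹⁻¹)]; simp [mul_assoc]
  have hδ : Commute (gel g * e * gel g⁻¹) e :=
    hcen _ (conj_mem_subAlgOver (fun x hx => (hg x).1 hx) (eInd_mem θ L))
  -- Primitivity applied to `g⁻¹` and conjugated back by `g` gives the other half: if `δ = g e g⁻¹`,
  -- then `e δ` is `0` or `δ`. Together with `δ e = e` this leaves `δ = e`, apart from
  -- orthogonality.
  have hback : ∀ {y : MonoidAlgebra ℚ G}, gel g⁻¹ * e * gel g⁻¹⁻¹ * e = y →
      e * (gel g * e * gel g⁻¹) = gel g * y * gel g⁻¹ := by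
    rintro y rfl
    rw [inv_inv, ← conj_mul_conj, conj_conj_inv]
  rcases hconj g⁻¹ hg' with h2 | h2
  · left
    rw [hδ.eq, hback h2, mul_zero, zero_mul]
  · right
    rw [gel_commute_iff, ← hback h2, ← hδ.eq, h1]

/-- An element which normalizes `H` and the kernel of `θ` centralizes `e_ℚ(θ)`. -/
theorem commute_eInd_of_normalizes {g : G} (hgH : ∀ h, h ∈ H ↔ g * h * g⁻¹ ∈ H)
    (hgK : ∀ h, h ∈ kerChar θ ↔ g * h * g⁻¹ ∈ kerChar θ) : Commute (gel g) (eInd H θ) := by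
  refine (conj_eInd_mul_eq_zero_or θ le_rfl (shodaCond_self _) hgH).resolve_left fun h0 => ?_
  have hcen : ∀ a ∈ subAlgOver ℚ H, Commute a (eInd H θ) := fun a ha =>
    commute_of_mem_subAlgOver ha fun g hg => commute_gel_eInd θ le_rfl hg
  -- An orthogonal conjugate would meet the criterion of `eq_zero_of_mul_eInd_eq_zero`: as `g`
  -- normalizes `H` and `K`, conjugation fixes `K̂` and carries each `M̂` above `K` to an idempotent
  -- that still annihilates `e_ℚ(θ)`.
  have hδ0 : gel g * eInd H θ * gel g⁻¹ = 0 := by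
    apply eq_zero_of_mul_eInd_eq_zero θ _ _ h0
    · obtain ⟨M', hM', hc⟩ := exists_conj_hat (M := kerChar θ) g
      have : M' = kerChar θ := by
        ext x; rw [hM', ← hgK]
      rw [this] at hc
      rw [← conj_conj_inv g (hat (kerChar θ)), conj_mul_conj, hc,
        ← (hcen _ (hat_mem (kerChar_le θ))).eq, hat_kerChar_mul_eInd]
    · intro M hM
      obtain ⟨M', hM', hc⟩ := exists_conj_hat (M := M) g
      have hle : M' ≤ H := fun x hx => (hgH x).2 (hM.1 ((hM' x).1 hx))
      have hnle : ¬ M' ≤ kerChar θ := by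
        obtain ⟨m, hm, hmk⟩ := SetLike.not_le_iff_exists.1 (not_le_of_gt hM.2.2)
        intro h
        have h1 : g⁻¹ * m * g ∈ M' := by rw [hM']; simpa [mul_assoc] using hm
        have h2 := (hgK _).1 (h h1)
        exact hmk (by simpa [mul_assoc] using h2)
      rw [← conj_conj_inv g (hat M), conj_mul_conj, hc, ← (hcen _ (hat_mem hle)).eq,
        hat_mul_eInd_eq_zero θ hle hnle, mul_zero, zero_mul]
  have : eInd H θ = gel g⁻¹ * (gel g * eInd H θ * gel g⁻¹) * gel g := by
    simp only [mul_assoc, gel_inv_mul_gel, mul_one]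
    rw [← mul_assoc, gel_inv_mul_gel, one_mul]
  rw [hδ0, mul_zero, zero_mul] at this
  exact eInd_self_ne_zero θ this

end Eps

/-! ### One step of the Clifford correspondence -/

section CliffordStep

open MonoidAlgebra

variable {G : Type u} [Group G] [Finite G] {H : Subgroup G} (θ : H →* ℂˣ)

omit [Finite G] in
theorem ShodaCond.mono {k : Type v} [Field k] {L M : Subgroup G} {ϑ : H →* k}
    (h : ShodaCond L ϑ) (hML : M ≤ L) : ShodaCond M ϑ :=
  fun g hg => h g (hML hg)

/-- The pair `M ≤ L` behaves like the inertia group of a linear constituent of `θ^L`: conjugation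
in `L` either fixes `e_ℚ(θ^M)` and normalizes `M`, or moves it to an orthogonal idempotent. -/
structure IsCliffordStep (L M : Subgroup G) : Prop where
  le : M ≤ L
  le_left : H ≤ M
  shoda : ShodaCond L (charHom θ)
  orthogonal : ∀ g ∈ L, ¬ Commute (gel g) (eInd M θ) →
    gel g * eInd M θ * gel g⁻¹ * eInd M θ = 0
  normal : ∀ g ∈ L, Commute (gel g) (eInd M θ) → ∀ h ∈ M, g * h * g⁻¹ ∈ M

/-- If `θ` extends `φ`, then `e_ℚ(φ)` fixes `e_ℚ(θ)`. -/
theorem eInd_mul_eInd_of_extends {A : Subgroup G} {φ : A →* ℂˣ} (hAH : A ≤ H)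
    (hext : ∀ a ∈ A, extChar θ a = extChar φ a) : eInd A φ * eInd H θ = eInd H θ := by
  have h1 : omega (charHom φ) * omega (charHom θ) = omega (charHom θ) := by
    refine omega_mul_of_forall _ fun a => ?_
    have h2 := single_mul_omega (charHom θ) ⟨a, hAH a.2⟩
    have h3 := hext a a.2
    rw [extChar_of_mem θ (hAH a.2), extChar_of_mem φ a.2] at h3
    have h4 : charHom θ ⟨a, hAH a.2⟩ = charHom φ a := h3
    rw [h4] at h2
    exact h2
  have h2 : baseChange G ℂ (eInd A φ) * omega (charHom θ) = omega (charHom θ) := by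
    rw [← h1, ← mul_assoc, baseChange_eInd_mul_omega φ le_rfl (shodaCond_self _)]
  apply mul_eInd_self_eq
  rw [← sub_eq_zero, ← sub_one_mul, ← map_one (baseChange G (linField θ)), ← map_sub,
    baseChange_mul_omega_iff, map_sub, map_one, sub_one_mul, h2, sub_self]

omit [Finite G] in
theorem conj_mem_iff_of_forall {L M : Subgroup G} (h : ∀ g ∈ L, ∀ a ∈ M, g * a * g⁻¹ ∈ M) {g : G}
    (hg : g ∈ L) (x : G) : x ∈ M ↔ g * x * g⁻¹ ∈ M := by
  refine ⟨h g hg x, fun hx => ?_⟩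
  have := h g⁻¹ (L.inv_mem hg) _ hx
  simpa [mul_assoc] using this

omit [Finite G] in
theorem commute_gel_inv {g : G} {a : MonoidAlgebra ℚ G} (h : Commute (gel g) a) :
    Commute (gel g⁻¹) a := by
  rw [gel_commute_iff, inv_inv, mul_assoc, ← h.eq, ← mul_assoc, gel_inv_mul_gel, one_mul]

variable {A L : Subgroup G} {φ : A →* ℂˣ}

omit [Finite G] in
-- Invariance of `φ` is rephrased through its kernel, because an element that centralizes `e_ℚ(φ)`
-- preserves `ker φ` but may replace `φ` by a Galois conjugate.
theorem extChar_conj_eq_iff {g x : G} (hx : x ∈ A) (hgx : g * x * g⁻¹ ∈ A) :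
    extChar φ (g * x * g⁻¹) = extChar φ x ↔ g * x * g⁻¹ * x⁻¹ ∈ kerChar φ := by
  have hm : g * x * g⁻¹ * x⁻¹ ∈ A := A.mul_mem hgx (A.inv_mem hx)
  rw [mem_kerChar φ hm, extChar_of_mem _ hx, extChar_of_mem _ hgx, Units.val_inj]
  have : (⟨g * x * g⁻¹ * x⁻¹, hm⟩ : A) = ⟨g * x * g⁻¹, hgx⟩ * ⟨x, hx⟩⁻¹ := rfl
  rw [this, map_mul, map_inv, mul_inv_eq_one]

/-- An element of `L` which centralizes `e_ℚ(φ)` normalizes the inertia group of `φ`. -/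
theorem conj_mem_inertia (hAL : ∀ g ∈ L, ∀ a ∈ A, g * a * g⁻¹ ∈ A) {g : G} (hg : g ∈ L)
    (hc : Commute (gel g) (eInd A φ)) {h : G} (hh : h ∈ inertia L φ) :
    g * h * g⁻¹ ∈ inertia L φ := by
  obtain ⟨hhL, hφ⟩ := hh
  have hghL : g * h * g⁻¹ ∈ L := L.mul_mem (L.mul_mem hg hhL) (L.inv_mem hg)
  refine ⟨hghL, fun x => ?_⟩
  by_cases hx : x ∈ A
  · rw [extChar_conj_eq_iff hx (hAL _ hghL x hx)]
    -- Since `h` fixes `φ` at `y = g⁻¹ x g`, the commutator `h y h⁻¹ y⁻¹` lies in `ker φ`; its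
    -- conjugate by `g` is the commutator of `g h g⁻¹` and `x`.
    have hy : g⁻¹ * x * g ∈ A := by simpa using hAL g⁻¹ (L.inv_mem hg) x hx
    have h1 := (extChar_conj_eq_iff hy (hAL h hhL _ hy)).1 (hφ _)
    have h2 := conj_mem_kerChar φ (hAL g hg) hc h1
    convert! h2 using 1
    group
  · rw [extChar_of_notMem _ hx, extChar_of_notMem]
    rwa [← conj_mem_iff_of_forall hAL hghL]

/-- Let `f = e_ℚ(φ)` and let `e` be the idempotent of `θ` induced to the inertia group `I`; then `f
e = e = e f`. As `A` is normalized by `L`, an element `g` of `L` either centralizes `f` or moves it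
to an orthogonal idempotent. In the second case `e` is moved to an orthogonal idempotent as well, so
`g` cannot centralize `e`, which is nonzero. In the first case `g` normalizes `I`, and primitivity
of `e` in the centre of `ℚI` gives the alternative for `e`. -/
theorem isCliffordStep_inertia (hAH : A ≤ H) (hAL : ∀ g ∈ L, ∀ a ∈ A, g * a * g⁻¹ ∈ A)
    (hext : ∀ a ∈ A, extChar θ a = extChar φ a) (hHM : H ≤ inertia L φ)
    (hS : ShodaCond L (charHom θ)) : IsCliffordStep θ L (inertia L φ) := by
  have hML : inertia L φ ≤ L := fun g hg => hg.1
  have hSM : ShodaCond (inertia L φ) (charHom θ) := hS.mono hML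
  have hf : ∀ g ∈ inertia L φ, Commute (gel g) (eInd A φ) := by
    intro g hg
    have hA := conj_mem_iff_of_forall hAL (hML hg)
    refine commute_eInd_of_normalizes φ hA fun h => ?_
    by_cases hh : h ∈ A
    · have h1 := hg.2 h
      rw [extChar_of_mem φ hh, extChar_of_mem φ ((hA h).1 hh), Units.val_inj] at h1
      rw [mem_kerChar φ hh, mem_kerChar φ ((hA h).1 hh), h1]
    · exact ⟨fun h1 => absurd (kerChar_le φ h1) hh,
        fun h1 => absurd ((hA h).2 (kerChar_le φ h1)) hh⟩
  have hfe : eInd A φ * eInd (inertia L φ) θ = eInd (inertia L φ) θ := by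
    simpa using central_mul_eInd θ hHM hf (r := 1)
      (by rw [eInd_mul_eInd_of_extends θ hAH hext, one_smul])
  have hef : eInd (inertia L φ) θ * eInd A φ = eInd (inertia L φ) θ := by
    rw [← (commute_of_mem_subAlgOver (eInd_mem θ _) hf).eq.symm, hfe]
  have horth : ∀ g, gel g * eInd A φ * gel g⁻¹ * eInd A φ = 0 →
      gel g * eInd (inertia L φ) θ * gel g⁻¹ * eInd (inertia L φ) θ = 0 := by
    intro g h
    have h1 : gel g * eInd (inertia L φ) θ * gel g⁻¹ = gel g * eInd (inertia L φ) θ * gel g⁻¹ *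
        (gel g * eInd A φ * gel g⁻¹) := by rw [conj_mul_conj, hef]
    rw [h1]
    conv_lhs => rw [← hfe]
    rw [mul_assoc (gel g * _ * _), ← mul_assoc (gel g * eInd A φ * gel g⁻¹), h, zero_mul, hfe,
      mul_zero]
  have hcase : ∀ g ∈ L, gel g * eInd A φ * gel g⁻¹ * eInd A φ = 0 ∨ Commute (gel g) (eInd A φ) :=
    fun g hg => conj_eInd_mul_eq_zero_or φ le_rfl (shodaCond_self _)
      (conj_mem_iff_of_forall hAL hg)
  refine ⟨hML, hHM, hS, fun g hg hnc => ?_, fun g hg hc h hh => ?_⟩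
  · rcases hcase g hg with h | h
    · exact horth g h
    · refine (conj_eInd_mul_eq_zero_or θ hHM hSM fun x => ⟨fun hx => ?_, fun hx => ?_⟩).resolve_right
        hnc
      · exact conj_mem_inertia hAL hg h hx
      · have := conj_mem_inertia hAL (L.inv_mem hg) (commute_gel_inv h) hx
        simpa [mul_assoc] using this
  · refine conj_mem_inertia hAL hg ((hcase g hg).resolve_left fun h0 => ?_) hh
    have h1 := horth g h0
    rw [gel_commute_iff.1 hc, eInd_mul_self θ hHM hSM] at h1
    have h2 := eInd_mul_eInd_self θ hHM hSM
    rw [h1, zero_mul] at h2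
    exact eInd_self_ne_zero θ h2.symm

end CliffordStep

/-! ### Decomposition of `e_ℚ(θ^L)` into orthogonal conjugates -/

section StepSum

open MonoidAlgebra

variable {G : Type u} [Group G] [Finite G] {H : Subgroup G} {θ : H →* ℂˣ} {L M : Subgroup G}

namespace IsCliffordStep

variable (h : IsCliffordStep θ L M)

include h

omit [Finite G] in
theorem shoda_right : ShodaCond M (charHom θ) := h.shoda.mono h.le

theorem idem : eInd M θ * eInd M θ = eInd M θ := eInd_mul_self θ h.le_left h.shoda_right

theorem eInd_mul_eInd : eInd L θ * eInd M θ = eInd M θ := by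
  have hHL := h.le_left.trans h.le
  simpa using central_mul_eInd θ h.le_left
    (fun g hg => commute_gel_eInd θ hHL (h.le hg)) (r := 1)
    (by rw [eInd_mul_eInd_self θ hHL h.shoda, one_smul])

omit [Finite G] in
theorem mul_single_mul_eq_zero {g : G} (hg : g ∈ L) (hc : ¬ Commute (gel g) (eInd M θ)) :
    eInd M θ * gel g * eInd M θ = 0 := by
  have h1 := h.orthogonal g⁻¹ (L.inv_mem hg) fun h' => hc (by simpa using commute_gel_inv h')
  rw [inv_inv, mul_assoc, mul_assoc, ← mul_assoc (eInd M θ)] at h1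
  rw [← one_mul (eInd M θ * gel g * eInd M θ), ← gel_mul_gel_inv g, mul_assoc, h1, mul_zero]

/-- `e_ℚ(θ^L)` is the sum of the distinct `L`-conjugates of `e_ℚ(θ^M)`. -/
theorem exists_eInd_eq_sum : ∃ t : Fin ((cen L (eInd M θ)).relIndex L) → G, (∀ i, t i ∈ L) ∧
    (∀ i j, i ≠ j → ¬ Commute (gel ((t i)⁻¹ * t j)) (eInd M θ)) ∧
    eInd L θ = ∑ i, gel (t i) * eInd M θ * gel (t i)⁻¹ := by
  classical
  set e := eInd M θ with he
  set C := (cen L e).subgroupOf L with hC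
  have hHL := h.le_left.trans h.le
  have := Fintype.ofFinite (L ⧸ C)
  have hmemC : ∀ x : L, x ∈ C ↔ Commute (gel (x : G)) e := fun x =>
    ⟨fun hx => hx.2, fun hx => ⟨x.2, hx⟩⟩
  have hwd : ∀ x y : L, (x : L ⧸ C) = y →
      gel (x : G) * e * gel (x : G)⁻¹ = gel (y : G) * e * gel (y : G)⁻¹ := by
    intro x y hxy
    have h1 := (hmemC _).1 (QuotientGroup.eq.1 hxy)
    have h2 : (y : G) = x * ((x⁻¹ * y : L) : G) := by simp
    rw [h2]
    have h3 : gel ((x : G) * ((x⁻¹ * y : L) : G)) = gel (x : G) * gel ((x⁻¹ * y : L) : G) :=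
      map_mul _ _ _
    have h4 : gel ((x : G) * ((x⁻¹ * y : L) : G))⁻¹ =
        gel ((x⁻¹ * y : L) : G)⁻¹ * gel (x : G)⁻¹ := by
      rw [mul_inv_rev]; exact map_mul _ _ _
    have h5 := gel_commute_iff.1 h1
    rw [h3, h4]
    conv_lhs => rw [← h5]
    simp only [mul_assoc]
  let E : L ⧸ C → MonoidAlgebra ℚ G := fun q => gel (q.out : G) * e * gel (q.out : G)⁻¹
  have hE : ∀ x : L, E x = gel (x : G) * e * gel (x : G)⁻¹ := fun x =>
    hwd _ _ (QuotientGroup.out_eq' _)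
  have horth : ∀ p q : L ⧸ C, p ≠ q → ¬ Commute (gel ((p.out : G)⁻¹ * q.out)) e := by
    intro p q hpq hc
    apply hpq
    rw [← QuotientGroup.out_eq' p, ← QuotientGroup.out_eq' q, QuotientGroup.eq]
    exact (hmemC _).2 hc
  have hcentral : ∀ g ∈ L, Commute (gel g) (∑ q, E q) := by
    intro g hg
    rw [gel_commute_iff, Finset.mul_sum, Finset.sum_mul]
    refine Fintype.sum_equiv (MulAction.toPerm (⟨g, hg⟩ : L)) _ _ fun q => ?_
    have h1 : MulAction.toPerm (⟨g, hg⟩ : L) q = ((⟨g, hg⟩ * q.out : L) : L ⧸ C) := by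
      conv_lhs => rw [← QuotientGroup.out_eq' q]
      rfl
    rw [h1, hE]
    simp only [E, Subgroup.coe_mul, mul_inv_rev, gel, map_mul, mul_assoc]
  have hse : (∑ q, E q) * e = e := by
    rw [Finset.sum_mul, Finset.sum_eq_single ((1 : L) : L ⧸ C)]
    · have h1 := hE 1
      simp only [OneMemClass.coe_one, inv_one, gel, map_one, one_mul, mul_one] at h1
      rw [h1, h.idem]
    · intro q _ hq
      refine h.orthogonal _ q.out.2 fun hc => hq ?_
      rw [← QuotientGroup.out_eq' q, QuotientGroup.eq, mul_one]
      exact C.inv_mem ((hmemC _).2 hc)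
    · simp
  -- The sum of the conjugates is central and fixes `e`, hence also `e_ℚ(θ)` and then `e_ℚ(θ^L)`.
  -- Conversely `e_ℚ(θ^L)` fixes `e` and all its conjugates, so the two agree.
  have h1 : (∑ q, E q) * eInd L θ = eInd L θ := by
    have : (∑ q, E q) * eInd H θ = eInd H θ := by
      rw [← eInd_mul_eInd_self θ h.le_left h.shoda_right, ← mul_assoc, hse]
    simpa using central_mul_eInd θ hHL hcentral (r := 1) (by rw [this, one_smul])
  have h2 : (∑ q, E q) * eInd L θ = ∑ q, E q := by
    rw [Finset.sum_mul]
    refine Finset.sum_congr rfl fun q _ => ?_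
    have hc := commute_gel_eInd θ hHL (L.inv_mem q.out.2)
    have hc' : Commute e (eInd L θ) := commute_of_mem_subAlgOver
      (subAlgOver_mono h.le (eInd_mem θ M)) fun g hg => commute_gel_eInd θ hHL hg
    simp only [E]
    rw [mul_assoc, hc.eq, ← mul_assoc, mul_assoc _ e, hc'.eq, h.eInd_mul_eInd]
  have hk : Nat.card (L ⧸ C) = (cen L e).relIndex L := rfl
  let eqv : L ⧸ C ≃ Fin ((cen L e).relIndex L) := Finite.equivFinOfCardEq hk
  refine ⟨fun i => ((eqv.symm i).out : L), fun i => (eqv.symm i).out.2,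
    fun i j hij => horth _ _ fun h' => hij (eqv.symm.injective h'), ?_⟩
  rw [← h1, h2]
  exact (Equiv.sum_comp eqv.symm E).symm

end IsCliffordStep

end StepSum

/-! ### Matrix rings and crossed products -/

section Matrices

/-- Matrix units `a i * b j` relative to an idempotent turn a corner ring into a matrix ring. -/
theorem exists_matrix_hom {B P ι : Type*} [Ring B] [Ring P] [Fintype ι] [DecidableEq ι]
    (ψ : P →ₙ+* B) (hψ : Function.Injective ψ) (a b : ι → B)
    (hab : ∀ i j, b i * a j = if i = j then ψ 1 else 0) :
    ∃ F : Matrix ι ι P →ₙ+* B, Function.Injective F ∧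
      ∀ m, F m = ∑ i, ∑ j, a i * ψ (m i j) * b j := by
  have hl : ∀ x, ψ 1 * ψ x = ψ x := fun x => by rw [← map_mul, one_mul]
  have hr : ∀ x, ψ x * ψ 1 = ψ x := fun x => by rw [← map_mul, mul_one]
  let F : Matrix ι ι P → B := fun m => ∑ i, ∑ j, a i * ψ (m i j) * b j
  -- The action on the columns `a l` gives multiplicativity, and multiplying it by `b i` recovers
  -- the entry `ψ (m i l)`, whence injectivity.
  have hright : ∀ m l x, F m * (a l * ψ x) = ∑ i, a i * ψ (m i l * x) := by
    intro m l x
    simp only [F, Finset.sum_mul]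
    refine Finset.sum_congr rfl fun i _ => ?_
    rw [Finset.sum_eq_single l]
    · rw [mul_assoc, ← mul_assoc (b l), hab, if_pos rfl, hl, mul_assoc, ← map_mul]
    · intro j _ hj
      rw [mul_assoc, ← mul_assoc (b j), hab, if_neg hj, zero_mul, mul_zero]
    · simp
  refine ⟨⟨⟨F, fun m m' => ?_⟩, ?_, fun m m' => ?_⟩, ?_, fun _ => rfl⟩
  · have h1 : F m * F m' = ∑ l, ∑ n, (∑ i, a i * ψ (m i l * m' l n)) * b n := by
      conv_lhs => rw [show F m' = ∑ l, ∑ n, a l * ψ (m' l n) * b n from rfl]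
      rw [Finset.mul_sum]
      refine Finset.sum_congr rfl fun l _ => ?_
      rw [Finset.mul_sum]
      refine Finset.sum_congr rfl fun n _ => ?_
      rw [← mul_assoc, hright]
    rw [h1]
    simp only [F, Matrix.mul_apply, map_sum, Finset.mul_sum, Finset.sum_mul]
    exact (Finset.sum_congr rfl fun i _ => Finset.sum_comm).trans
      (Finset.sum_comm.trans (Finset.sum_congr rfl fun l _ => Finset.sum_comm))
  · simp [F]
  · simp only [F, Matrix.add_apply, map_add, mul_add, add_mul, Finset.sum_add_distrib]
  · rw [injective_iff_map_eq_zero]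
    intro m hm
    ext i j
    apply hψ
    rw [Matrix.zero_apply, map_zero]
    have h1 := hright m j 1
    change F m = 0 at hm
    rw [hm, zero_mul] at h1
    have h2 : b i * ∑ i, a i * ψ (m i j * 1) = ψ (m i j) := by
      rw [Finset.mul_sum, Finset.sum_eq_single i]
      · rw [← mul_assoc, hab, if_pos rfl, hl, mul_one]
      · intro l _ hl
        rw [← mul_assoc, hab, if_neg (Ne.symm hl), zero_mul]
      · simp
    rw [← h2, ← h1, mul_zero]

end Matrices

namespace CrossedProduct

variable {R : Type v} [Ring R] {Q : Type w} [Group Q] {S : CrossedSystem R Q}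

/-- The element `r u_q` of a crossed product. -/
def single (S : CrossedSystem R Q) (q : Q) (r : R) : CrossedProduct S := Finsupp.single q r

/-- The coefficients of an element of a crossed product. -/
def coeff (x : CrossedProduct S) : Q →₀ R := x

theorem single_mul_single (p q : Q) (r s : R) :
    single S p r * single S q s = single S (p * q) (r * S.σ p s * S.τ p q) :=
  S.mul_single_single p q r s

@[elab_as_elim]
theorem induction_linear {p : CrossedProduct S → Prop} (x : CrossedProduct S) (zero : p 0)
    (add : ∀ x y, p x → p y → p (x + y)) (single : ∀ q r, p (single S q r)) : p x :=
  Finsupp.induction_linear (motive := p) x zero add single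

end CrossedProduct

/-! ### The corner `e ℚL e` as a crossed product, and the matrix ring over it -/

section Crossed

open MonoidAlgebra

variable {G : Type u} [Group G] [Finite G] {H : Subgroup G} {θ : H →* ℂˣ} {L M : Subgroup G}

omit [Finite G] in
theorem coeff_eq_zero_of_mem_subAlgOver {k : Type v} [Field k] {L : Subgroup G}
    {a : MonoidAlgebra k G} (ha : a ∈ subAlgOver k L) {g : G} (hg : g ∉ L) : a.coeff g = 0 := by
  refine subAlgOver_induction (p := fun a => a.coeff g = 0) (by simp)
    (fun a b ha hb => by simp [ha, hb]) (fun x hx r => ?_) ha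
  rw [coeff_single, Finsupp.single_eq_of_ne]
  rintro rfl
  exact hg hx

theorem component_subset {a : MonoidAlgebra ℚ G} (ha : a ∈ component M θ) :
    a ∈ subAlgOver ℚ M := by
  obtain ⟨b, hb, rfl⟩ := ha
  exact mul_mem hb (eInd_mem θ M)

namespace IsCliffordStep

variable (h : IsCliffordStep θ L M)

include h

omit h in
theorem eInd_mem_component : eInd M θ ∈ component M θ := ⟨1, one_mem _, (one_mul _).symm⟩

omit h in
theorem gel_mul_mem_component {g : G} (hg : g ∈ M) : gel g * eInd M θ ∈ component M θ :=
  ⟨gel g, gel_mem_subAlg hg, rfl⟩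

theorem component_mul_eInd {a : MonoidAlgebra ℚ G} (ha : a ∈ component M θ) :
    a * eInd M θ = a :=
  ((mem_component θ h.le_left h.shoda_right).1 ha).2

theorem commute_of_mem_right {a : MonoidAlgebra ℚ G} (ha : a ∈ subAlgOver ℚ M) :
    Commute a (eInd M θ) :=
  commute_of_mem_subAlgOver ha fun _ hg => commute_gel_eInd θ h.le_left hg

theorem eInd_mul_component {a : MonoidAlgebra ℚ G} (ha : a ∈ component M θ) :
    eInd M θ * a = a := by
  rw [← (h.commute_of_mem_right (component_subset ha)).eq, h.component_mul_eInd ha]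

theorem conj_mem_component {g : G} (hg : g ∈ L) (hc : Commute (gel g) (eInd M θ))
    {a : MonoidAlgebra ℚ G} (ha : a ∈ component M θ) : gel g * a * gel g⁻¹ ∈ component M θ := by
  rw [mem_component θ h.le_left h.shoda_right]
  refine ⟨conj_mem_subAlgOver (h.normal g hg hc) (component_subset ha), ?_⟩
  conv_lhs => rw [← gel_commute_iff.1 hc]
  rw [conj_mul_conj, h.component_mul_eInd ha]

variable {R : Type u} [Ring R] (η : component M θ ≃+* R)

/-- The component is only a non-unital ring, so the preimage of `1` is found by uniqueness of the
identity. -/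
theorem coe_symm_one : (η.symm 1 : MonoidAlgebra ℚ G) = eInd M θ := by
  have h1 : (⟨eInd M θ, eInd_mem_component⟩ : component M θ) * η.symm 1 =
      ⟨eInd M θ, eInd_mem_component⟩ := by
    apply η.injective
    rw [map_mul, η.apply_symm_apply, mul_one]
  have h2 := congrArg Subtype.val h1
  rw [← h.eInd_mul_component (η.symm 1).2]
  exact h2

variable {C : Subgroup G} (hC : C = cen L (eInd M θ)) [(M.subgroupOf C).Normal]

include hC

variable {T : C ⧸ M.subgroupOf C → C} {S : CrossedSystem R (C ⧸ M.subgroupOf C)}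

/-- The crossed product is the corner `e ℚL e`, with `e = e_ℚ(θ^M)`. -/
theorem exists_crossed_hom (hS : IsConjSystem θ M C η T S) :
    ∃ ψ : CrossedProduct S →ₙ+* MonoidAlgebra ℚ G, Function.Injective ψ ∧
      ψ 1 = eInd M θ ∧ (∀ x, ψ x ∈ subAlgOver ℚ L) ∧
      ∀ X ∈ subAlgOver ℚ L, ∃ x, ψ x = eInd M θ * X * eInd M θ := by
  classical
  set e := eInd M θ with he
  have hmemC : ∀ g ∈ C, g ∈ L ∧ Commute (gel g) e := fun g hg => by rwa [hC] at hg
  have hTL : ∀ q, (T q : G) ∈ L := fun q => (hmemC _ (T q).2).1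
  have hTc : ∀ q, Commute (gel (T q : G)) e := fun q => (hmemC _ (T q).2).2
  let ρ : R →+ MonoidAlgebra ℚ G :=
    { toFun := fun r => η.symm r
      map_zero' := by rw [map_zero]; rfl
      map_add' := fun r s => by rw [map_add]; rfl }
  have hρmem : ∀ r, ρ r ∈ component M θ := fun r => (η.symm r).2
  have hρη : ∀ a : component M θ, ρ (η a) = a := fun a => by
    change ((η.symm (η a) : component M θ) : MonoidAlgebra ℚ G) = a
    rw [η.symm_apply_apply]
  have hρmul : ∀ r s, ρ (r * s) = ρ r * ρ s := fun r s => by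
    change ((η.symm (r * s) : component M θ) : MonoidAlgebra ℚ G) = _
    rw [map_mul]; rfl
  have hρσ : ∀ q r, ρ (S.σ q r) = gel (T q : G) * ρ r * gel (T q : G)⁻¹ := by
    intro q r
    obtain ⟨b, hb, hb'⟩ := hS.action q (η.symm r)
    rw [η.apply_symm_apply] at hb'
    rw [hb', hρη, hb]
    rfl
  have hρτ : ∀ p q, ρ (S.τ p q) * gel (T (p * q) : G) = e * (gel (T p : G) * gel (T q : G)) := by
    intro p q
    obtain ⟨g, hg, hpq, c, hc, hc'⟩ := hS.twisting p q
    have h1 : gel (T p : G) * gel (T q : G) = gel g * gel (T (p * q) : G) := by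
      rw [gel, gel, ← map_mul, hpq, map_mul]
    rw [hc', hρη, hc, h1, (commute_gel_eInd θ h.le_left hg).eq, mul_assoc]
  -- The basis element `u_q` is represented by `T q`; the actual image of `1 · u_q` is `e T(q)`.
  let ψ : CrossedProduct S → MonoidAlgebra ℚ G :=
    fun x => x.coeff.sum fun q r => ρ r * gel (T q : G)
  have hψadd : ∀ x y, ψ (x + y) = ψ x + ψ y := fun x y =>
    Finsupp.sum_add_index' (fun _ => by rw [map_zero, zero_mul])
      (fun _ _ _ => by rw [map_add, add_mul])
  have hψzero : ψ 0 = 0 := Finsupp.sum_zero_index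
  have hψs : ∀ q r, ψ (CrossedProduct.single S q r) = ρ r * gel (T q : G) := fun q r =>
    Finsupp.sum_single_index (by rw [map_zero, zero_mul])
  have hψmul : ∀ x y, ψ (x * y) = ψ x * ψ y := by
    intro x y
    induction x using CrossedProduct.induction_linear with
    | zero => rw [zero_mul, hψzero, zero_mul]
    | add x x' hx hx' => rw [add_mul, hψadd, hx, hx', ← add_mul, hψadd]
    | single p r =>
      induction y using CrossedProduct.induction_linear with
      | zero => rw [mul_zero, hψzero, mul_zero]
      | add y y' hy hy' => rw [mul_add, hψadd, hy, hy', ← mul_add, hψadd]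
      | single q s =>
        rw [CrossedProduct.single_mul_single, hψs, hψs, hψs, hρmul, hρmul, mul_assoc, hρτ, hρσ]
        have h2 : gel (T p : G) * ρ s * gel (T p : G)⁻¹ * e =
            gel (T p : G) * ρ s * gel (T p : G)⁻¹ :=
          h.component_mul_eInd (h.conj_mem_component (hTL p) (hTc p) (hρmem s))
        rw [mul_assoc (ρ r), ← mul_assoc _ e, h2, mul_assoc (ρ r)]
        congr 1
        simp only [mul_assoc]
        rw [← mul_assoc (gel (T p : G)⁻¹), gel_inv_mul_gel, one_mul]
  have hψL : ∀ x, ψ x ∈ subAlgOver ℚ L := by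
    intro x
    induction x using CrossedProduct.induction_linear with
    | zero => rw [hψzero]; exact zero_mem _
    | add x x' hx hx' => rw [hψadd]; exact add_mem hx hx'
    | single p r =>
      rw [hψs]
      exact mul_mem (subAlgOver_mono h.le (component_subset (hρmem r)))
        (single_mem_subAlgOver (hTL p) 1)
  have hMC : M ≤ C := fun g hg => by
    rw [hC]; exact ⟨h.le hg, commute_gel_eInd θ h.le_left hg⟩
  have hrange : ∀ g ∈ C, ∀ r, ∃ x, ψ x = e * single g r * e := by
    intro g hg r
    -- Writing `g = (g T(q)⁻¹) T(q)` with the first factor in `M` exhibits `e g e` as an image.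
    set q : C ⧸ M.subgroupOf C := QuotientGroup.mk ⟨g, hg⟩ with hq
    have h1 : (⟨g, hg⟩ : C) * (T q)⁻¹ ∈ M.subgroupOf C := by
      rw [← QuotientGroup.eq_one_iff, QuotientGroup.mk_mul, QuotientGroup.mk_inv, hS.section_eq q,
        ← hq, mul_inv_cancel]
    have h2 : g * (T q : G)⁻¹ ∈ M := h1
    refine ⟨CrossedProduct.single S q (η ⟨single (g * (T q : G)⁻¹) r * e, _,
      single_mem_subAlgOver h2 r, rfl⟩), ?_⟩
    rw [hψs, hρη]
    have hgc : Commute (single g r) e := by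
      have h3 : single g r = r • gel g := by simp [gel]
      rw [h3]
      exact (hmemC g hg).2.smul_left r
    change single (g * (T q : G)⁻¹) r * e * gel (T q : G) = _
    rw [mul_assoc, ← (hTc q).eq, ← mul_assoc, ← hgc.eq, mul_assoc (single g r), h.idem]
    congr 1
    rw [gel, of_apply, single_mul_single]
    simp
  refine ⟨⟨⟨ψ, hψmul⟩, hψzero, hψadd⟩, ?_, ?_, hψL, ?_⟩
  · rw [injective_iff_map_eq_zero]
    intro x hx
    change ψ x = 0 at hx
    refine Finsupp.ext fun q₀ => ?_
    change x.coeff q₀ = 0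
    have hinj : ∀ r, ρ r = 0 → r = 0 := fun r hr => by
      have : η.symm r = 0 := Subtype.ext hr
      simpa using this
    apply hinj
    ext m
    by_cases hm : m ∈ M
    -- The summand for `q` is supported on the coset `M T(q)`. These cosets are disjoint, so the
    -- coefficients of `ψ x` on `M T(q₀)` are those of the `q₀`-th summand alone.
    · have h1 : (ψ x).coeff (m * T q₀) = (ρ (x.coeff q₀)).coeff m := by
        change (x.coeff.sum fun q r => ρ r * gel (T q : G)).coeff (m * T q₀) = _
        rw [Finsupp.sum, coeff_sum, Finsupp.finsetSum_apply]
        have h2 : ∀ q, (ρ (x.coeff q) * gel (T q : G)).coeff (m * T q₀) =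
            if q = q₀ then (ρ (x.coeff q)).coeff m else 0 := by
          intro q
          rw [gel, of_apply, coeff_mul_single_apply, mul_one]
          split_ifs with hqq
          · rw [hqq, mul_inv_cancel_right]
          · refine coeff_eq_zero_of_mem_subAlgOver (component_subset (hρmem _)) fun hmem => hqq ?_
            rw [mul_assoc, M.mul_mem_cancel_left hm] at hmem
            have h3 : T q₀ * (T q)⁻¹ ∈ M.subgroupOf C := hmem
            rw [← QuotientGroup.eq_one_iff, QuotientGroup.mk_mul, QuotientGroup.mk_inv,
              hS.section_eq, hS.section_eq, mul_inv_eq_one] at h3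
            exact h3.symm
        rw [Finset.sum_congr rfl fun q _ => h2 q, Finset.sum_ite_eq']
        split_ifs with hs
        · rfl
        · rw [Finsupp.notMem_support_iff.1 hs, map_zero]; rfl
      rw [← h1, hx]
      rfl
    · rw [coeff_eq_zero_of_mem_subAlgOver (component_subset (hρmem _)) hm]
      rfl
  · obtain ⟨x, hx⟩ := hrange 1 C.one_mem 1
    have h1 : e * single (1 : G) 1 * e = e := by rw [← one_def, mul_one, h.idem]
    rw [h1] at hx
    -- As `e = ψ x` for some `x`, one has `e = ψ (x * 1) = e ψ(1) = ψ(1)`.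
    have h2 := hψmul x 1
    have h3 : ∀ y, e * ψ y = ψ y := by
      intro y
      induction y using CrossedProduct.induction_linear with
      | zero => rw [hψzero, mul_zero]
      | add y y' hy hy' => rw [hψadd, mul_add, hy, hy']
      | single p r => rw [hψs, ← mul_assoc, h.eInd_mul_component (hρmem r)]
    rw [mul_one, hx, h3] at h2
    exact h2.symm
  · intro X hX
    refine subAlgOver_induction (p := fun X => ∃ x, ψ x = e * X * e) ⟨0, by rw [hψzero]; simp⟩
      ?_ (fun g hg r => ?_) hX
    · rintro X Y ⟨x, hx⟩ ⟨y, hy⟩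
      exact ⟨x + y, by rw [hψadd, hx, hy, mul_add, add_mul]⟩
    · by_cases hc : Commute (gel g) e
      · exact hrange g (by rw [hC]; exact ⟨hg, hc⟩) r
      · refine ⟨0, ?_⟩
        have h1 : single g r = r • gel g := by simp [gel]
        rw [hψzero, h1, mul_smul_comm, smul_mul_assoc, h.mul_single_mul_eq_zero hg hc, smul_zero]

/-- The component of `θ^L` is a matrix ring over a crossed product over the component of `θ^M`. -/
theorem nonempty_equiv_matrix (hS : IsConjSystem θ M C η T S) :
    Nonempty (component L θ ≃+* Matrix (Fin ((cen L (eInd M θ)).relIndex L))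
      (Fin ((cen L (eInd M θ)).relIndex L)) (CrossedProduct S)) := by
  classical
  obtain ⟨ψ, hψ, hψ1, hψL, hψr⟩ := h.exists_crossed_hom η hC hS
  obtain ⟨t, htL, htc, hsum⟩ := h.exists_eInd_eq_sum
  have hHL := h.le_left.trans h.le
  have heL : eInd M θ ∈ subAlgOver ℚ L := subAlgOver_mono h.le (eInd_mem θ M)
  have hcomm : ∀ x ∈ subAlgOver ℚ L, Commute x (eInd L θ) := fun x hx =>
    commute_of_mem_subAlgOver hx fun g hg => commute_gel_eInd θ hHL hg
  have hgL : ∀ {g}, g ∈ L → gel g ∈ subAlgOver ℚ L := fun hg => single_mem_subAlgOver hg 1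
  -- Orthogonality of the conjugates `t_i e t_i⁻¹` says that `(e t_i⁻¹)(t_j e)` is `e` for `i = j`
  -- and `0` otherwise.
  obtain ⟨F, hF, hFm⟩ := exists_matrix_hom ψ hψ (fun i => gel (t i) * eInd M θ)
    (fun j => eInd M θ * gel (t j)⁻¹)
    (fun i j => by
      have h1 : eInd M θ * gel (t i)⁻¹ * (gel (t j) * eInd M θ) =
          eInd M θ * gel ((t i)⁻¹ * t j) * eInd M θ := by
        rw [gel, gel, gel, map_mul]; simp only [mul_assoc]
      rw [h1, hψ1]
      split_ifs with hij
      · rw [hij, inv_mul_cancel, gel, map_one, mul_one, h.idem]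
      · exact h.mul_single_mul_eq_zero (L.mul_mem (L.inv_mem (htL i)) (htL j)) (htc i j hij))
  have hmem : ∀ m, F m ∈ component L θ := by
    intro m
    rw [mem_component θ hHL h.shoda, hFm]
    refine ⟨sum_mem fun i _ => sum_mem fun j _ => mul_mem (mul_mem (mul_mem (hgL (htL i)) heL)
      (hψL _)) (mul_mem heL (hgL (L.inv_mem (htL j)))), ?_⟩
    simp only [Finset.sum_mul]
    refine Finset.sum_congr rfl fun i _ => Finset.sum_congr rfl fun j _ => ?_
    have h1 : eInd M θ * gel (t j)⁻¹ * eInd L θ = eInd M θ * gel (t j)⁻¹ := by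
      rw [mul_assoc, (hcomm _ (hgL (L.inv_mem (htL j)))).eq, ← mul_assoc, (hcomm _ heL).eq,
        h.eInd_mul_eInd]
    rw [mul_assoc, h1]
  refine ⟨(RingEquiv.ofBijective (S := component L θ)
    ({ toFun := fun m => ⟨F m, hmem m⟩
       map_zero' := Subtype.ext (map_zero F)
       map_add' := fun a b => Subtype.ext (map_add F a b)
       map_mul' := fun a b => Subtype.ext (map_mul F a b) } : _ →ₙ+* component L θ)
    ⟨fun a b hab => hF (congrArg Subtype.val hab), ?_⟩).symm⟩
  rintro ⟨X, hX⟩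
  obtain ⟨hXL, hXe⟩ := (mem_component θ hHL h.shoda).1 hX
  -- The entries are the Peirce components of `X`, recovered by expanding both factors in `X = e_L X
  -- e_L` (with `e_L = e_ℚ(θ^L)`) as sums of the conjugates of `e`.
  have hX' : ∀ i j, ∃ x, ψ x = eInd M θ * (gel (t i)⁻¹ * X * gel (t j)) * eInd M θ := fun i j =>
    hψr _ (mul_mem (mul_mem (hgL (L.inv_mem (htL i))) hXL) (hgL (htL j)))
  choose m hm using hX'
  refine ⟨Matrix.of m, Subtype.ext ?_⟩
  change F (Matrix.of m) = X
  have h1 : X = eInd L θ * X * eInd L θ := by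
    rw [← (hcomm X hXL).eq, hXe, hXe]
  conv_rhs => rw [h1, hsum]
  rw [hFm, Finset.sum_mul, Finset.sum_mul]
  refine Finset.sum_congr rfl fun i _ => ?_
  rw [Finset.mul_sum]
  refine Finset.sum_congr rfl fun j _ => ?_
  rw [Matrix.of_apply, hm]
  have hl : ∀ y, eInd M θ * (eInd M θ * y) = eInd M θ * y := fun y => by rw [← mul_assoc, h.idem]
  simp only [mul_assoc, hl]

end IsCliffordStep

end Crossed

/-! ### Existence of the crossed systems -/

section Systems

open MonoidAlgebra

variable {G : Type u} [Group G] [Finite G] {H : Subgroup G} {θ : H →* ℂˣ} {L M C : Subgroup G}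

namespace IsCliffordStep

variable (h : IsCliffordStep θ L M)

include h

omit [Finite G] in
theorem subgroupOf_normal (hC : C = cen L (eInd M θ)) : (M.subgroupOf C).Normal := by
  subst hC
  exact ⟨fun m hm g => h.normal g g.2.1 g.2.2 m hm⟩

theorem le_cen : M ≤ cen L (eInd M θ) := fun _ hg =>
  ⟨h.le hg, commute_gel_eInd θ h.le_left hg⟩

/-- Conjugation by an element which centralizes `e_ℚ(θ^M)`, on the component of `θ^M`. -/
def conjEquiv {g : G} (hg : g ∈ L) (hc : Commute (gel g) (eInd M θ)) :
    component M θ ≃+* component M θ where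
  toFun a := ⟨gel g * a * gel g⁻¹, h.conj_mem_component hg hc a.2⟩
  invFun a := ⟨gel g⁻¹ * a * gel g, by
    simpa using h.conj_mem_component (L.inv_mem hg) (commute_gel_inv hc) a.2⟩
  left_inv a := Subtype.ext (by simpa using conj_conj_inv g⁻¹ (a : MonoidAlgebra ℚ G))
  right_inv a := Subtype.ext (conj_conj_inv g (a : MonoidAlgebra ℚ G))
  map_mul' a b := Subtype.ext (conj_mul_conj g _ _).symm
  map_add' a b := Subtype.ext (by
    change gel g * ((a : MonoidAlgebra ℚ G) + b) * gel g⁻¹ = _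
    rw [mul_add, add_mul]; rfl)

variable {R : Type u} [Ring R] (η : component M θ ≃+* R)

omit h in
theorem gel_eInd_mul_gel_eInd (h : IsCliffordStep θ L M) {c d : G}
    (hd : Commute (gel d) (eInd M θ)) :
    gel c * eInd M θ * (gel d * eInd M θ) = gel (c * d) * eInd M θ := by
  rw [mul_assoc, ← mul_assoc (eInd M θ), ← hd.eq, mul_assoc (gel d), h.idem, ← mul_assoc]
  congr 1
  exact (map_mul _ _ _).symm

/-- The unit of `R` which corresponds to `g e_ℚ(θ^M)`. -/
def gelUnit {g : G} (hg : g ∈ M) : Rˣ where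
  val := η ⟨gel g * eInd M θ, gel_mul_mem_component hg⟩
  inv := η ⟨gel g⁻¹ * eInd M θ, gel_mul_mem_component (M.inv_mem hg)⟩
  val_inv := by
    rw [← map_mul, ← η.apply_symm_apply 1]
    congr 1
    refine Subtype.ext ((h.gel_eInd_mul_gel_eInd
      (commute_gel_eInd θ h.le_left (M.inv_mem hg))).trans ?_)
    rw [h.coe_symm_one, mul_inv_cancel, gel, map_one, one_mul]
  inv_val := by
    rw [← map_mul, ← η.apply_symm_apply 1]
    congr 1
    refine Subtype.ext ((h.gel_eInd_mul_gel_eInd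
      (commute_gel_eInd θ h.le_left hg)).trans ?_)
    rw [h.coe_symm_one, inv_mul_cancel, gel, map_one, one_mul]

omit [Ring R] in
-- With `x = T p`, `y = T q` and `z = T (p q)` this is the compatibility of action and twisting in a
-- crossed system.
theorem conj_conj_mul_gel_eInd {z : G} (hz : z ∈ L) (hc : Commute (gel z) (eInd M θ))
    {a : MonoidAlgebra ℚ G} (ha : a ∈ component M θ) (x y : G) :
    gel x * (gel y * a * gel y⁻¹) * gel x⁻¹ * (gel (x * y * z⁻¹) * eInd M θ) =
      gel (x * y * z⁻¹) * eInd M θ * (gel z * a * gel z⁻¹) := by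
  have hgel : ∀ x y : G, gel (x * y) = gel x * gel y := fun x y => map_mul _ _ _
  have hinv : ∀ (x : G) (b : MonoidAlgebra ℚ G), gel x⁻¹ * (gel x * b) = b := fun x b => by
    rw [← mul_assoc, ← hgel, inv_mul_cancel, gel, map_one, one_mul]
  rw [mul_assoc (gel (x * y * z⁻¹)), h.eInd_mul_component (h.conj_mem_component hz hc ha)]
  simp only [hgel, mul_assoc, hinv]
  rw [(commute_gel_inv hc).eq, ← mul_assoc a, h.component_mul_eInd ha]

/-- Coset representatives commute with `e`, so the axioms of a crossed system reduce to identities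
in `G`; both sides of the cocycle condition become `T(p) T(q) T(s) T(pqs)⁻¹ e`. -/
theorem exists_isConjSystem (hC : C = cen L (eInd M θ)) [(M.subgroupOf C).Normal] :
    ∃ (T : C ⧸ M.subgroupOf C → C) (S : CrossedSystem R (C ⧸ M.subgroupOf C)),
      IsConjSystem θ M C η T S := by
  set T : C ⧸ M.subgroupOf C → C := Quotient.out with hT
  have hTq : ∀ q, (T q : C ⧸ M.subgroupOf C) = q := fun q => QuotientGroup.out_eq' q
  have hmemC : ∀ g ∈ C, g ∈ L ∧ Commute (gel g) (eInd M θ) := fun g hg => by rwa [hC] at hg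
  have hTL : ∀ q, (T q : G) ∈ L := fun q => (hmemC _ (T q).2).1
  have hTc : ∀ q, Commute (gel (T q : G)) (eInd M θ) := fun q => (hmemC _ (T q).2).2
  have hτ : ∀ p q, ((T p : G) * (T q : G) * (T (p * q) : G)⁻¹) ∈ M := by
    intro p q
    have : T p * T q * (T (p * q))⁻¹ ∈ M.subgroupOf C := by
      rw [← QuotientGroup.eq_one_iff, QuotientGroup.mk_mul, QuotientGroup.mk_mul,
        QuotientGroup.mk_inv, hTq, hTq, hTq, mul_inv_cancel]
    exact this
  have hgel : ∀ x y : G, gel x * gel y = gel (x * y) := fun x y => (map_mul _ _ _).symm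
  let S : CrossedSystem R (C ⧸ M.subgroupOf C) :=
    { σ := fun q => (η.symm.trans (h.conjEquiv (hTL q) (hTc q))).trans η
      τ := fun p q => h.gelUnit η (hτ p q)
      action := by
        intro p q r
        simp only [RingEquiv.trans_apply, RingEquiv.symm_apply_apply, gelUnit]
        rw [← map_mul, ← map_mul]
        congr 1
        apply Subtype.ext
        change gel (T p : G) * (gel (T q : G) * (η.symm r : MonoidAlgebra ℚ G) * gel (T q : G)⁻¹) *
          gel (T p : G)⁻¹ * (gel ((T p : G) * (T q : G) * (T (p * q) : G)⁻¹) * eInd M θ) =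
          gel ((T p : G) * (T q : G) * (T (p * q) : G)⁻¹) * eInd M θ *
            (gel (T (p * q) : G) * (η.symm r : MonoidAlgebra ℚ G) * gel (T (p * q) : G)⁻¹)
        exact h.conj_conj_mul_gel_eInd (hTL (p * q)) (hTc (p * q)) (η.symm r).2 _ _
      cocycle := by
        intro p q s
        simp only [RingEquiv.trans_apply, RingEquiv.symm_apply_apply, gelUnit]
        rw [← map_mul, ← map_mul]
        congr 1
        apply Subtype.ext
        change gel ((T p : G) * (T q : G) * (T (p * q) : G)⁻¹) * eInd M θ *
          (gel ((T (p * q) : G) * (T s : G) * (T (p * q * s) : G)⁻¹) * eInd M θ) =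
          gel (T p : G) * (gel ((T q : G) * (T s : G) * (T (q * s) : G)⁻¹) * eInd M θ) * gel (T p : G)⁻¹ *
          (gel ((T p : G) * (T (q * s) : G) * (T (p * (q * s)) : G)⁻¹) * eInd M θ)
        have h1 : gel (T p : G) * (gel ((T q : G) * (T s : G) * (T (q * s) : G)⁻¹) * eInd M θ) *
            gel (T p : G)⁻¹ = gel ((T p : G) * ((T q : G) * (T s : G) * (T (q * s) : G)⁻¹) *
              (T p : G)⁻¹) * eInd M θ := by
          rw [mul_assoc, mul_assoc, ← (commute_gel_inv (hTc p)).eq, ← mul_assoc, ← mul_assoc, hgel,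
            hgel]
        rw [h1, h.gel_eInd_mul_gel_eInd (commute_gel_eInd θ h.le_left (hτ _ _)),
          h.gel_eInd_mul_gel_eInd (commute_gel_eInd θ h.le_left (hτ _ _)), mul_assoc p q s]
        congr 2
        group }
  refine ⟨T, S, hTq, fun q a => ⟨h.conjEquiv (hTL q) (hTc q) a, rfl, ?_⟩, fun p q =>
    ⟨_, hτ p q, by group, _, rfl, rfl⟩⟩
  change η (h.conjEquiv (hTL q) (hTc q) (η.symm (η a))) = _
  rw [η.symm_apply_apply]

end IsCliffordStep

end Systems

/-! ### Paths to a leaf -/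

section Paths

open MonoidAlgebra

variable {G : Type u} [Group G] [Finite G] {H : Subgroup G} {θ : H →* ℂˣ}

omit [Finite G] in
-- An element `g` of `L` outside the inertia group moves `φ` at some `x` in `A`. Since `θ` extends
-- `φ`, the pair `x`, `g x g⁻¹` is a witness for `θ`.
theorem ShodaCond.of_inertia {A L : Subgroup G} {φ : A →* ℂˣ} (hAH : A ≤ H)
    (hAL : ∀ g ∈ L, ∀ a ∈ A, g * a * g⁻¹ ∈ A) (hext : ∀ a ∈ A, extChar θ a = extChar φ a)
    (hS : ShodaCond (inertia L φ) (charHom θ)) : ShodaCond L (charHom θ) := by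
  intro g hg hgH
  by_cases hgi : g ∈ inertia L φ
  · exact hS g hgi hgH
  have : ∃ x, extChar φ (g * x * g⁻¹) ≠ extChar φ x := by
    by_contra! hcon
    exact hgi ⟨hg, hcon⟩
  obtain ⟨x, hx⟩ := this
  have hxA : x ∈ A := by
    by_contra hxA
    apply hx
    rw [extChar_of_notMem _ hxA, extChar_of_notMem]
    rwa [← conj_mem_iff_of_forall hAL hg]
  have hyA := hAL g hg x hxA
  refine ⟨⟨x, hAH hxA⟩, ⟨g * x * g⁻¹, hAH hyA⟩, by simp, fun heq => hx ?_⟩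
  rw [← hext _ hyA, ← hext _ hxA, extChar_of_mem θ (hAH hyA), extChar_of_mem θ (hAH hxA)]
  exact heq.symm

variable {c : CliffordChoice G} {N : Subgroup G} {n : ℕ} {v : ℕ → LinTriple G}

namespace CliffordChoice.IsLeafPath

variable (hp : c.IsLeafPath N n v H θ)

include hp

omit [Finite G] in
theorem edge_data {i : ℕ} (hi : 1 ≤ i) (hin : i < n) :
    (v (i + 1)).H = inertia (v i).H (v (i + 1)).θ ∧ (v i).A ≤ (v (i + 1)).A ∧
      (∀ g ∈ (v i).H, ∀ a ∈ (v (i + 1)).A, g * a * g⁻¹ ∈ (v (i + 1)).A) ∧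
      ∀ a ∈ (v i).A, extChar (v (i + 1)).θ a = extChar (v i).θ a := by
  have ht := (hp.vertex i hi hin.le).toIsCharTriple
  obtain ⟨-, φ, hφ, hs⟩ := hp.edge i hi hin
  obtain ⟨h1, h2, -⟩ := c.reps_subset (v i) ht hφ
  have h3 := c.abelianOver (v i) ht
  rw [hs]
  exact ⟨rfl, h1, fun g hg a ha => h3.normal.conj_mem ⟨a, h3.le ha⟩ ha ⟨g, hg⟩, h2⟩

omit [Finite G] in
-- Descending induction from the leaf, where Shoda's condition is vacuous; each edge passes from an
-- inertia group to the group above it.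
theorem node_data {i : ℕ} (hi : 1 ≤ i) (hin : i ≤ n) :
    (v i).A ≤ H ∧ H ≤ (v i).H ∧ (∀ a ∈ (v i).A, extChar θ a = extChar (v i).θ a) ∧
      ShodaCond (v i).H (charHom θ) := by
  induction hin using Nat.decreasingInduction with
  | self =>
    rw [hp.leaf]
    exact ⟨le_rfl, le_rfl, fun _ _ => rfl, shodaCond_self _⟩
  | of_succ i hin ih =>
    obtain ⟨h1, h2, h3, h4⟩ := ih (by omega)
    obtain ⟨e1, e2, e3, e4⟩ := hp.edge_data hi hin
    rw [e1] at h2 h4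
    exact ⟨e2.trans h1, h2.trans fun g hg => hg.1,
      fun a ha => (h3 a (e2 ha)).trans (e4 a ha), h4.of_inertia h1 e3 h3⟩

theorem isCliffordStep {i : ℕ} (hi : 1 ≤ i) (hin : i < n) :
    IsCliffordStep θ (v i).H (v (i + 1)).H := by
  obtain ⟨h1, h2, h3, -⟩ := hp.node_data (i := i + 1) (by omega) hin
  obtain ⟨e1, -, e3, -⟩ := hp.edge_data hi hin
  rw [e1] at h2 ⊢
  exact isCliffordStep_inertia θ h1 e3 h3 h2 (hp.node_data hi hin.le).2.2.2

theorem cen_eSum_eq {i : ℕ} (hi : 1 ≤ i) (hin : i < n) :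
    cen (v i).H (eSum (v (i + 1)).H H (kerChar θ)) = cen (v i).H (eInd (v (i + 1)).H θ) :=
  cen_eSum θ (hp.isCliffordStep hi hin).le_left _

/-- No induction is needed: a step of `IsIterated` already contains an isomorphism `η` from the
component below onto the coefficient ring. The argument works for any `η` and any representatives.
-/
theorem nonempty_equiv {i : ℕ} {R : Type u} {inst : Ring R}
    (hR : IsIterated v n θ i R inst) : Nonempty (component (v i).H θ ≃+* R) := by
  cases hR with
  | base =>
    rw [hp.leaf]
    obtain ⟨f⟩ := nonempty_component_equiv_cyclotomic θ
    exact ⟨f.trans ULift.ringEquiv.symm⟩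
  | step i R inst hi hin hR hN η T S hS =>
    exact (hp.isCliffordStep hi hin).nonempty_equiv_matrix η (hp.cen_eSum_eq hi hin) hS

/-- Building each further stage requires some `η` for the ring already built, and `nonempty_equiv`
supplies it. -/
theorem exists_isIterated {i : ℕ} (hi : 1 ≤ i) (hin : i ≤ n) :
    ∃ (R : Type u) (inst : Ring R), IsIterated v n θ i R inst := by
  induction hin using Nat.decreasingInduction with
  | self => exact ⟨_, _, IsIterated.base⟩
  | of_succ i hin ih =>
    obtain ⟨R, inst, hR⟩ := ih (by omega)
    have h := hp.isCliffordStep hi hin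
    have hC := hp.cen_eSum_eq hi hin
    have hN := h.subgroupOf_normal hC
    obtain ⟨η⟩ := hp.nonempty_equiv hR
    obtain ⟨T, S, hS⟩ := h.exists_isConjSystem η hC
    exact ⟨_, _, IsIterated.step i R inst hi hin hR hN η T S hS⟩

/-- The last subgroup `A_n` is `H`, which is therefore normalized by `H_{n-1}`. For such elements,
centralizing `e_ℚ(θ)` and normalizing the kernel of `θ` are equivalent. -/
theorem cen_eSum_last (hn : 2 ≤ n) : cen (v (n - 1)).H (eSum H H (kerChar θ)) =
    Subgroup.normalizer (kerChar θ : Set G) ⊓ (v (n - 1)).H := by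
  have hn1 : n - 1 + 1 = n := by omega
  obtain ⟨-, -, hAL, -⟩ := hp.edge_data (i := n - 1) (by omega) (by omega)
  rw [hn1, hp.leaf] at hAL
  change ∀ g ∈ (v (n - 1)).H, ∀ a ∈ H, g * a * g⁻¹ ∈ H at hAL
  rw [cen_eSum θ le_rfl]
  ext g
  rw [Subgroup.mem_inf, Subgroup.mem_normalizer_iff]
  constructor
  · rintro ⟨hg, hc⟩
    refine ⟨fun x => ⟨conj_mem_kerChar θ (hAL g hg) hc, fun hx => ?_⟩, hg⟩
    have := conj_mem_kerChar θ (hAL g⁻¹ (inv_mem hg)) (commute_gel_inv hc) hx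
    simpa [mul_assoc] using this
  · rintro ⟨hK, hg⟩
    exact ⟨hg, commute_eInd_of_normalizes θ (conj_mem_iff_of_forall hAL hg) hK⟩

end CliffordChoice.IsLeafPath

end Paths

end

theorem theorem6p2 {G : Type u} [Group G] [Finite G] (hG : InClassC G) (c : CliffordChoice G)
    (N : Subgroup G) [N.Normal] (n : ℕ) (v : ℕ → LinTriple G) (H : Subgroup G) (θ : H →* ℂˣ)
    (hleaf : c.IsLeafPath N n v H θ) :
    (∃ (R : Type u) (inst : Ring R), IsIterated v n θ 1 R inst) ∧
    (∀ (R : Type u) (inst : Ring R), IsIterated v n θ 1 R inst →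
      Nonempty (component (⊤ : Subgroup G) θ ≃+* R)) ∧
    (∀ i, 1 ≤ i → i < n → (v (i + 1)).H ≤ cen (v i).H (eSum (v (i + 1)).H H (kerChar θ)) ∧
      cen (v i).H (eInd (v (i + 1)).H θ) = cen (v i).H (eSum (v (i + 1)).H H (kerChar θ))) ∧
    (2 ≤ n → cen (v (n - 1)).H (eSum H H (kerChar θ)) =
      Subgroup.normalizer (kerChar θ : Set G) ⊓ (v (n - 1)).H) := by
  refine ⟨hleaf.exists_isIterated le_rfl hleaf.one_le, fun R inst hR => ?_, fun i hi hin => ?_,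
    hleaf.cen_eSum_last⟩
  · have h := hleaf.nonempty_equiv hR
    rwa [hleaf.root] at h
  · rw [hleaf.cen_eSum_eq hi hin]
    exact ⟨(hleaf.isCliffordStep hi hin).le_cen, rfl⟩
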